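/- Let $\{Z_i\}_{i\in I}$ be independent standard quaternionic Gaussian random variables, i.e. $Z_i=\xi_{0}+\mathrm{i}\,\xi_{1}+\mathrm{j}\,\xi_{2}+\mathrm{k}\,\xi_{3}$ with $\xi_0,\dots,\xi_3$ (depending on $i$) independent real $N(0,1)$ variables. Let $X_1,\dots,X_{2n}$ be chosen, possibly with repetition, from the set $\{Z_i,\overline{Z_i}: i\in I\}$, and let $j_1,\dots,j_m\ge 0$ be integers with $j_1+\dots+j_m=2n$. Then the product of real parts below is integrable, and $$\mathbb{E}\big(\Re(X_1\cdots X_{j_1})\,\Re(X_{j_1+1}\cdots X_{j_1+j_2})\cdots\Re(X_{j_1+\dots+j_{m-1}+1}\cdots X_{2n})\big)=4^{\,n-m}\sum_{\Gamma\in\mathcal M}(-2)^{\chi(\Gamma)},$$ where an empty product is $1$ and the sum over an empty family is $0$. Here $\mathcal M$ is the (possibly empty) set of Möbius graphs $\Gamma$ of the following kind. There are $m$ labelled vertices, which are oriented disks; the half-edges at the $v$-th vertex are labelled, in their cyclic order, by the $j_v$ consecutive variables of the $v$-th block. The $2n$ half-edges are joined in pairs by $n$ ribbons, each either untwisted (preserving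 the local orientations) or twisted (reversing them); an untwisted ribbon may join the half-edges labelled $X_a$ and $X_b$ only if $X_a=\overline{X_b}$, and a twisted one only if $X_a=X_b$. The Euler characteristic is $\chi(\Gamma)=v(\Gamma)-e(\Gamma)+f(\Gamma)$, where $v(\Gamma)=m$ and $e(\Gamma)=n$ are the numbers of vertices and edges, and the number of faces $f(\Gamma)$ is the number of boundary components of the surface obtained by gluing the ribbons to the vertex disks (so an isolated vertex has one face). -/

import Mathlib

open MeasureTheory ProbabilityTheory
open scoped Quaternion BigOperators

/-- The Borel sigma-algebra on the real quaternions. -/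
noncomputable instance quaternionMeasurableSpace : MeasurableSpace ℍ[ℝ] := borel ℍ[ℝ]

instance quaternionBorelSpace : BorelSpace ℍ[ℝ] := ⟨rfl⟩

/-- The four real coordinates of a quaternion `x₀ + i x₁ + j x₂ + k x₃`. -/
def quaternionCoord (q : ℍ[ℝ]) : Fin 4 → ℝ := ![q.re, q.imI, q.imJ, q.imK]

/-- `Z` is a standard quaternionic Gaussian random variable: its four real coordinates are
independent with law `N(0,1)`. -/
structure IsStandardQuaternionGaussian {Ω : Type*} [MeasurableSpace Ω]
    (Z : Ω → ℍ[ℝ]) (μ : Measure Ω) : Prop where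
  hasLaw : ∀ i : Fin 4, HasLaw (fun ω => quaternionCoord (Z ω) i) (gaussianReal 0 1) μ
  indep : iIndepFun (fun (i : Fin 4) (ω : Ω) => quaternionCoord (Z ω) i) μ

/-- Half-edges at vertices with prescribed degrees: the half-edge `⟨v, k⟩` is the `k`-th half-edge
emanating from the vertex `v`, in the cyclic order given by the local orientation of `v`. -/
abbrev HalfEdge {V : Type*} (d : V → ℕ) : Type _ := (v : V) × Fin (d v)

/-- A Möbius graph with labelled vertices `V` of degrees `d`, whose half-edges are labelled too:
the half-edges are joined in pairs by ribbons, and each ribbon is either untwisted (it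
preserves the local orientations) or twisted (it reverses them). -/
@[ext]
structure MobiusGraph {V : Type*} (d : V → ℕ) where
  /-- The other end of the ribbon. -/
  mate : HalfEdge d → HalfEdge d
  mate_mate : ∀ h, mate (mate h) = h
  mate_ne : ∀ h, mate h ≠ h
  /-- Whether the ribbon carried by a half-edge is twisted. -/
  twisted : HalfEdge d → Bool
  twisted_mate : ∀ h, twisted (mate h) = twisted h

namespace MobiusGraph

variable {V : Type*} {d : V → ℕ}

/-- The two sides of the ribbons at their ends: `(h, false)` is the side of the half-edge `h` that
comes first in the orientation of its vertex, and `(h, true)` is the side that comes second. -/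
abbrev Side (d : V → ℕ) : Type _ := HalfEdge d × Bool

/-- Consecutive sides in the boundary of the surface obtained by gluing the ribbons to the vertex
disks. Along the disk of `v` the second side of each half-edge is followed by the
first side of the next half-edge in the cyclic order. Along an untwisted ribbon the first side at
one end is the second side at the other end; along a twisted ribbon first is joined to
first and second to second. -/
inductive SideAdj (Γ : MobiusGraph d) : Side d → Side d → Prop
  | corner (v : V) (k : Fin (d v)) :
      SideAdj Γ (⟨v, k⟩, true) (⟨v, finRotate (d v) k⟩, false)
  | ribbon_untwisted (h : HalfEdge d) (b : Bool) (hh : Γ.twisted h = false) :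
      SideAdj Γ (h, b) (Γ.mate h, !b)
  | ribbon_twisted (h : HalfEdge d) (b : Bool) (hh : Γ.twisted h = true) :
      SideAdj Γ (h, b) (Γ.mate h, b)

/-- The closed curves traced by following the sides of the ribbons (classes of the equivalence
relation generated by `SideAdj`). -/
def SideCycle (Γ : MobiusGraph d) : Type _ := Quot Γ.SideAdj

/-- The faces of a Möbius graph are the disks glued to the boundary curves of the ribbon surface:
there is one for each cycle of ribbon sides, and one for each isolated vertex, whose
disk has a boundary circle that meets no ribbon. -/
def Face (Γ : MobiusGraph d) : Type _ := Γ.SideCycle ⊕ {v : V // d v = 0}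

/-- The edges of a Möbius graph, as unordered pairs of half-edges. -/
def edgeSet (Γ : MobiusGraph d) : Set (Sym2 (HalfEdge d)) :=
  Set.range fun h => s(h, Γ.mate h)

/-- The Euler characteristic `v(Γ) - e(Γ) + f(Γ)`. -/
noncomputable def eulerChar (Γ : MobiusGraph d) : ℤ :=
  (Nat.card V : ℤ) - (Γ.edgeSet.ncard : ℤ) + (Nat.card Γ.Face : ℤ)

/-- `Γ` is compatible with a labelling `x` of its half-edges if each untwisted ribbon joins a pair
`x`, `star x`, and each twisted ribbon joins a pair `x`, `x`. -/
def Compatible {A : Type*} [Star A] (Γ : MobiusGraph d) (x : HalfEdge d → A) : Prop :=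
  ∀ h, (Γ.twisted h = false → x (Γ.mate h) = star (x h)) ∧
    (Γ.twisted h = true → x (Γ.mate h) = x h)

instance instFiniteMobiusGraph [Finite V] : Finite (MobiusGraph d) :=
  Finite.of_injective
    (fun Γ : MobiusGraph d => ((Γ.mate, Γ.twisted) :
      (HalfEdge d → HalfEdge d) × (HalfEdge d → Bool)))
    (fun _ _ h => MobiusGraph.ext (congrArg Prod.fst h) (congrArg Prod.snd h))

noncomputable instance instFintypeMobiusGraph [Finite V] : Fintype (MobiusGraph d) := Fintype.ofFinite _

open Classical in
/-- The finite family of all Möbius graphs with vertex degrees `d` that are compatible with the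
labelling `x` of the half-edges. -/
noncomputable def compatibleGraphs {A : Type*} [Star A] [Finite V] (x : HalfEdge d → A) :
    Finset (MobiusGraph d) :=
  Finset.univ.filter fun Γ => Γ.Compatible x

end MobiusGraph

/-- Position in the sequence `X_1, …, X_N` of the `k`-th letter of the `v`-th block, when the
sequence is cut into consecutive blocks of lengths `d 0, …, d (m-1)`. -/
def blockIndex {m N : ℕ} (d : Fin m → ℕ) (hd : ∑ v, d v = N) (p : HalfEdge d) : Fin N :=
  Fin.cast hd (finSigmaFinEquiv p)

/-- The random variable `∏ᵥ Re (product of the v-th block of X, in order)`. -/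
noncomputable def reProduct {Ω : Type*} {m N : ℕ} (d : Fin m → ℕ) (hd : ∑ v, d v = N)
    (X : Fin N → Ω → ℍ[ℝ]) (ω : Ω) : ℝ :=
  ∏ v : Fin m, ((List.ofFn fun k : Fin (d v) => X (blockIndex d hd ⟨v, k⟩) ω).prod).re

/-- A perfect matching of `H`, seen as a fixed-point-free involution. -/
structure IsPerfectMatching {H : Type*} (m : H → H) : Prop where
  invol : Function.Involutive m
  ne : ∀ h, m h ≠ h

/-- The two ends of each pair of a perfect matching can be coloured differently. -/
theorem IsPerfectMatching.exists_coloring {H : Type*} {m : H → H} (hm : IsPerfectMatching m) :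
    ∃ t : H → Bool, ∀ h, t (m h) = !t h := by
  classical
  let _ : LinearOrder H := linearOrderOfSTO WellOrderingRel
  refine ⟨fun h => decide (h < m h), fun h => ?_⟩
  simp only [hm.invol h]
  rcases lt_trichotomy h (m h) with h1 | h1 | h1
  · simp [h1, h1.le]
  · exact absurd h1.symm (hm.ne h)
  · simp [h1, h1.le]

/-- The union of two perfect matchings is a bipartite graph. -/
theorem IsPerfectMatching.exists_common_coloring {S : Type*} {a b : S → S}
    (ha : IsPerfectMatching a) (hb : IsPerfectMatching b) :
    ∃ t : S → Bool, (∀ x, t (a x) = !t x) ∧ ∀ x, t (b x) = !t x := by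
  let A : Equiv.Perm S := ha.invol.toPerm
  let B : Equiv.Perm S := hb.invol.toPerm
  have hAA : A * A = 1 := by ext x; exact ha.invol x
  have hBB : B * B = 1 := by ext x; exact hb.invol x
  have hAi : A⁻¹ = A := inv_eq_of_mul_eq_one_right hAA
  have hBi : B⁻¹ = B := inv_eq_of_mul_eq_one_right hBB
  let σ := A * B
  have hconj : A * σ * A⁻¹ = σ⁻¹ := by
    simp only [σ, mul_inv_rev, hAi, hBi, ← mul_assoc, hAA, one_mul]
  have hz (k : ℤ) : A * σ ^ k = σ ^ (-k) * A := by
    have := congrArg (· ^ k) hconj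
    simp only [conj_zpow] at this
    rw [inv_zpow', mul_inv_eq_iff_eq_mul] at this
    exact this
  have hz' (k : ℤ) (x : S) : A ((σ ^ k) x) = (σ ^ (-k)) (A x) :=
    congrArg (fun f : Equiv.Perm S => f x) (hz k)
  have hσA (x : S) : σ.SameCycle x (B (A x)) := ⟨-1, by
    simp only [zpow_neg, zpow_one, σ, mul_inv_rev, hAi, hBi]; rfl⟩
  -- If `A x = (σ ^ k) x`, the midpoint `(σ ^ j) x` is a fixed point of `a` when `k = 2 * j`, and of
  -- `b` when `k = 2 * j + 1`.
  have hnot (x : S) : ¬ σ.SameCycle x (A x) := by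
    rintro ⟨k, hk⟩
    rcases Int.even_or_odd' k with ⟨j, rfl | rfl⟩
    · refine ha.ne ((σ ^ j) x) ?_
      change A _ = _
      rw [hz', ← hk, ← Equiv.Perm.mul_apply, ← zpow_add]
      congr 2; ring
    · refine hb.ne ((σ ^ j) x) ?_
      have h1 : A ((σ ^ j) x) = A (B ((σ ^ j) x)) := by
        rw [hz', ← hk, ← Equiv.Perm.mul_apply, ← zpow_add]
        change _ = (σ * σ ^ j) x
        rw [← zpow_one_add]
        congr 2; ring
      exact (A.injective h1).symm
  have hcongr (x y : S) (h : σ.SameCycle x y) : σ.SameCycle (A x) (A y) := by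
    obtain ⟨k, rfl⟩ := h
    exact ⟨-k, (hz' k x).symm⟩
  -- `A` induces a matching of the cycles of `σ`. Since `A x` and `B x` lie in one cycle, a
  -- colouring of the cycles serves both matchings.
  let Q := Quotient (Equiv.Perm.SameCycle.setoid σ)
  let q : Q → Q := Quotient.map A fun x y h => hcongr x y h
  have hq : IsPerfectMatching q := by
    constructor
    · intro x
      induction x using Quotient.inductionOn with
      | h x => exact congrArg (Quotient.mk _) (ha.invol x)
    · intro x
      induction x using Quotient.inductionOn with
      | h x =>
        intro h
        exact hnot x (Quotient.exact h).symm
  obtain ⟨t, ht⟩ := hq.exists_coloring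
  refine ⟨fun x => t (Quotient.mk _ x), fun x => ht (Quotient.mk _ x), fun x => ?_⟩
  refine Eq.trans ?_ (ht (Quotient.mk _ x))
  refine congrArg t (Quotient.sound ?_)
  have := hσA (A x)
  rw [show A (A x) = x from ha.invol x] at this
  exact this.symm

/-! ### Sign and number of cycles -/

/-- The sign of a permutation in terms of its number of cycles, fixed points included. -/
theorem Equiv.Perm.sign_eq_neg_one_pow_card_add_card_sameCycle {α : Type*} [Fintype α]
    [DecidableEq α] (σ : Equiv.Perm α) :
    Equiv.Perm.sign σ =
      (-1) ^ (Fintype.card α + Nat.card (Quotient (Equiv.Perm.SameCycle.setoid σ))) := by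
  have hex (c : σ.cycleFactorsFinset) : ∃ x, x ∈ (c : Equiv.Perm α).support := by
    have := (Equiv.Perm.mem_cycleFactorsFinset_iff.1 c.2).1
    obtain ⟨x, hx, -⟩ := this
    exact ⟨x, Equiv.Perm.mem_support.2 hx⟩
  choose r hr using hex
  have hrc (c : σ.cycleFactorsFinset) : (c : Equiv.Perm α) = σ.cycleOf (r c) :=
    Equiv.Perm.cycle_is_cycleOf (hr c) c.2
  have hrσ (c : σ.cycleFactorsFinset) : σ (r c) ≠ r c :=
    Equiv.Perm.mem_support.1 (Equiv.Perm.mem_cycleFactorsFinset_support_le c.2 (hr c))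
  let F : σ.cycleFactorsFinset ⊕ Function.fixedPoints σ →
      Quotient (Equiv.Perm.SameCycle.setoid σ) :=
    Sum.elim (fun c => Quotient.mk _ (r c)) fun x => Quotient.mk _ x.1
  have hF : Function.Bijective F := by
    constructor
    · rintro (c | x) (c' | x') h
      · have h : σ.SameCycle (r c) (r c') := Quotient.exact h
        congr 1
        exact Subtype.ext (by rw [hrc c, hrc c', h.cycleOf_eq])
      · have h : σ.SameCycle (r c) x'.1 := Quotient.exact h
        exact absurd (h.apply_eq_self_iff.2 x'.2) (hrσ c)
      · have h : σ.SameCycle x.1 (r c') := Quotient.exact h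
        exact absurd (h.apply_eq_self_iff.1 x.2) (hrσ c')
      · have h : σ.SameCycle x.1 x'.1 := Quotient.exact h
        congr 1
        exact Subtype.ext (h.eq_of_left x.2)
    · intro y
      induction y using Quotient.inductionOn with
      | h x =>
        by_cases hx : σ x = x
        · exact ⟨Sum.inr ⟨x, hx⟩, rfl⟩
        · have hc : σ.cycleOf x ∈ σ.cycleFactorsFinset :=
            Equiv.Perm.cycleOf_mem_cycleFactorsFinset_iff.2 (Equiv.Perm.mem_support.2 hx)
          refine ⟨Sum.inl ⟨_, hc⟩, Quotient.sound ?_⟩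
          have := hr ⟨_, hc⟩
          exact ((Equiv.Perm.mem_support_cycleOf_iff.1 this).1).symm
  rw [← Nat.card_eq_of_bijective F hF, Nat.card_sum, Nat.card_eq_fintype_card,
    Nat.card_eq_fintype_card, Fintype.card_coe, Equiv.Perm.card_fixedPoints,
    Equiv.Perm.sign_of_cycleType]
  have hle := σ.sum_cycleType_le
  have hcard : Multiset.card σ.cycleType = σ.cycleFactorsFinset.card := by
    simp [Equiv.Perm.cycleType_def]
  obtain ⟨k, hk⟩ := Nat.exists_eq_add_of_le hle
  rw [← hcard, hk, Nat.add_sub_cancel_left,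
    show σ.cycleType.sum + k + (σ.cycleType.card + k) =
      σ.cycleType.sum + σ.cycleType.card + 2 * k by ring, pow_add _ _ (2 * k), pow_mul]
  simp

/-! ### Counting matchings, Gaussian moments and Wick's formula -/

theorem Nat.card_perfectMatching_odd {α : Type*} [Fintype α] (h : Odd (Fintype.card α)) :
    Nat.card {m : α → α // IsPerfectMatching m} = 0 := by
  classical
  rw [Nat.card_eq_zero]
  left
  constructor
  rintro ⟨m, hm⟩
  have := Equiv.Perm.two_dvd_card_support (σ := hm.invol.toPerm)
    (by ext x; exact hm.invol x)
  have hs : hm.invol.toPerm.support = Finset.univ := by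
    ext x; simp [hm.ne x]
  rw [hs, Finset.card_univ] at this
  exact (Nat.not_even_iff_odd.2 h) (even_iff_two_dvd.2 this)

/-- Matchings are the permutations of cycle type 2, …, 2 (`k` times), which the class formula
counts. -/
theorem Nat.card_perfectMatching_even {α : Type*} [Fintype α] (k : ℕ)
    (h : Fintype.card α = 2 * k) :
    Nat.card {m : α → α // IsPerfectMatching m} * (2 ^ k * k.factorial) = (2 * k).factorial := by
  classical
  have key := Equiv.Perm.card_of_cycleType_mul_eq α (Multiset.replicate k 2)
  rw [if_pos ⟨by simp [h, mul_comm], fun a ha => (Multiset.eq_of_mem_replicate ha).ge⟩] at key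
  have hc : Nat.card {m : α → α // IsPerfectMatching m} =
      (Finset.univ.filter fun g : Equiv.Perm α => g.cycleType = Multiset.replicate k 2).card := by
    rw [← Fintype.card_subtype, ← Nat.card_eq_fintype_card]
    refine Nat.card_congr
      { toFun := fun m => ⟨m.2.invol.toPerm, ?_⟩
        invFun := fun g => ⟨g.1, ?_, ?_⟩
        left_inv := fun m => rfl
        right_inv := fun g => by ext; rfl }
    · have h1 := Equiv.Perm.cycleType_of_pow_prime_eq_one (p := 2) (σ := m.2.invol.toPerm)
        (by ext x; exact m.2.invol x)
      have h2 : m.2.invol.toPerm.support = Finset.univ := by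
        ext x; simp [m.2.ne x]
      have h3 := Equiv.Perm.sum_cycleType m.2.invol.toPerm
      rw [h1, h2, Finset.card_univ, h] at h3
      rw [h1]
      congr 1
      simp at h3
      omega
    · intro x
      have h1 : g.1 ^ 2 = 1 := Equiv.Perm.pow_prime_eq_one_iff.2
        (by rw [g.2]; intro c; exact Multiset.eq_of_mem_replicate)
      exact congrArg (fun f : Equiv.Perm α => f x) h1
    · intro x
      have h3 := Equiv.Perm.sum_cycleType g.1
      rw [g.2] at h3
      have h4 : g.1.support = Finset.univ := by
        rw [← Finset.card_eq_iff_eq_univ, ← h3, h]; simp [mul_comm]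
      exact Equiv.Perm.mem_support.1 (h4 ▸ Finset.mem_univ x)
  rw [hc]
  rw [h] at key
  rw [← key]
  rcases k.eq_zero_or_pos with rfl | hk
  · simp
  · simp [Multiset.toFinset_replicate, hk.ne', mul_comm k 2]

theorem integrable_pow_gaussianReal (k : ℕ) :
    Integrable (fun x : ℝ => x ^ k) (gaussianReal 0 1) := by
  rcases k.eq_zero_or_pos with rfl | hk
  · simp
  have := (memLp_id_gaussianReal (μ := 0) (v := 1) (k : NNReal)).integrable_norm_rpow
    (by exact_mod_cast hk.ne') (by simp)
  refine (integrable_norm_iff (by fun_prop)).1 ?_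
  simpa using this

/-- Integration by parts, because the density φ satisfies φ' = -xφ. -/
theorem integral_pow_add_two_gaussianReal (k : ℕ) :
    ∫ x, x ^ (k + 2) ∂(gaussianReal 0 1) = (k + 1) * ∫ x, x ^ k ∂(gaussianReal 0 1) := by
  have hI (k : ℕ) : Integrable (fun x : ℝ => x ^ k * gaussianPDFReal 0 1 x) := by
    have := integrable_pow_gaussianReal k
    rw [gaussianReal_of_var_ne_zero _ one_ne_zero,
      integrable_withDensity_iff_integrable_smul' (by fun_prop) (by simp [gaussianPDF])] at this
    refine this.congr (ae_of_all _ fun x => ?_)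
    simp [gaussianPDF, gaussianPDFReal_nonneg, mul_comm]
  have hd (x : ℝ) : HasDerivAt (gaussianPDFReal 0 1) (-x * gaussianPDFReal 0 1 x) x := by
    have : gaussianPDFReal 0 1 =
        fun x => (√(2 * Real.pi))⁻¹ * Real.exp (- x ^ 2 / 2) := by
      ext x; simp [gaussianPDFReal]
    rw [this]
    have h1 : HasDerivAt (fun x : ℝ => -x ^ 2 / 2) (-x) x := by
      have := ((hasDerivAt_pow 2 x).neg).div_const 2
      refine this.congr_deriv ?_
      simp only [Nat.cast_ofNat, Nat.add_one_sub_one, pow_one]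
      ring
    refine (h1.exp.const_mul (√(2 * Real.pi))⁻¹).congr_deriv ?_
    ring
  have key := integral_mul_deriv_eq_deriv_mul_of_integrable
    (u := fun x : ℝ => x ^ (k + 1)) (v := gaussianPDFReal 0 1)
    (u' := fun x => (k + 1) * x ^ k) (v' := fun x => -x * gaussianPDFReal 0 1 x)
    (fun x _ => by simpa using hasDerivAt_pow (k + 1) x) (fun x _ => hd x)
    ((hI (k + 2)).neg.congr (ae_of_all _ fun x => by simp [Pi.mul_apply]; ring))
    (((hI k).const_mul (k + 1)).congr (ae_of_all _ fun x => by simp [Pi.mul_apply]; ring))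
    (hI (k + 1))
  rw [integral_gaussianReal_eq_integral_smul one_ne_zero,
    integral_gaussianReal_eq_integral_smul one_ne_zero, ← integral_const_mul]
  simp only [smul_eq_mul]
  have h1 : ∀ x : ℝ, gaussianPDFReal 0 1 x * x ^ (k + 2) =
      - (x ^ (k + 1) * (-x * gaussianPDFReal 0 1 x)) := fun x => by ring
  have h2 : ∀ x : ℝ, (k + 1) * (gaussianPDFReal 0 1 x * x ^ k) =
      (k + 1) * x ^ k * gaussianPDFReal 0 1 x := fun x => by ring
  simp only [h1, h2, integral_neg, key, neg_neg]

/-- For odd size both sides vanish; for size 2k both equal (2k)! / (2^k k!). Phrasing the moment as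
a count of matchings is what makes Wick's formula multiplicative over fibres. -/
theorem integral_pow_gaussianReal (α : Type*) [Fintype α] :
    ∫ x, x ^ Fintype.card α ∂(gaussianReal 0 1) =
      Nat.card {m : α → α // IsPerfectMatching m} := by
  rcases Nat.even_or_odd' (Fintype.card α) with ⟨k, hk | hk⟩
  · have h1 := Nat.card_perfectMatching_even k hk
    have h2 (k : ℕ) : (∫ x, x ^ (2 * k) ∂(gaussianReal 0 1)) * (2 ^ k * k.factorial) =
        (2 * k).factorial := by
      induction k with
      | zero => simp
      | succ k ih =>
        rw [show 2 * (k + 1) = 2 * k + 2 by ring, integral_pow_add_two_gaussianReal,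
          Nat.factorial_succ (2 * k + 1), Nat.factorial_succ (2 * k), Nat.factorial_succ k]
        push_cast
        rw [← ih]
        ring
    rw [hk]
    have h3 : ((2 : ℝ) ^ k * k.factorial) ≠ 0 := by positivity
    apply mul_right_cancel₀ h3
    rw [h2]
    exact_mod_cast h1.symm
  · rw [Nat.card_perfectMatching_odd ⟨k, hk⟩, hk]
    clear hk
    induction k with
    | zero => simp [integral_id_gaussianReal]
    | succ k ih =>
      rw [show 2 * (k + 1) + 1 = 2 * k + 1 + 2 by ring, integral_pow_add_two_gaussianReal, ih]
      simp

/-- A matching of `H` inside the fibres of `f` is a family of matchings of the fibres. -/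
def perfectMatchingFiberEquiv {H J : Type*} (f : H → J) :
    {m : H → H // IsPerfectMatching m ∧ ∀ h, f (m h) = f h} ≃
      ((j : J) → {m : {h // f h = j} → {h // f h = j} // IsPerfectMatching m}) where
  toFun m j := ⟨fun h => ⟨m.1 h, (m.2.2 h).trans h.2⟩,
    fun h => Subtype.ext (m.2.1.invol h), fun h e => m.2.1.ne h (congrArg Subtype.val e)⟩
  invFun m := ⟨fun h => (m (f h)).1 ⟨h, rfl⟩, by
    have hf (h : H) : f ((m (f h)).1 ⟨h, rfl⟩) = f h := ((m (f h)).1 ⟨h, rfl⟩).2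
    have haux (j : J) (x : {h // f h = j}) : (((m (f x)).1 ⟨x, rfl⟩ : {h // f h = f x}) : H) =
        (m j).1 x := by
      obtain ⟨x, rfl⟩ := x; rfl
    refine ⟨⟨fun h => ?_, fun h e => ?_⟩, hf⟩
    · exact (haux _ ((m (f h)).1 ⟨h, rfl⟩)).trans (congrArg Subtype.val ((m (f h)).2.invol _))
    · exact (m (f h)).2.ne _ (Subtype.ext e)⟩
  left_inv m := rfl
  right_inv m := by
    ext j x
    obtain ⟨x, rfl⟩ := x
    rfl

/-- Wick's formula for a product of members of a family of independent standard real Gaussian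
random variables. -/
theorem wick_iIndepFun {Ω H J : Type*} [MeasurableSpace Ω] {μ : Measure Ω} [Fintype H]
    {Y : J → Ω → ℝ} (hY : ∀ j, HasLaw (Y j) (gaussianReal 0 1) μ) (hind : iIndepFun Y μ)
    (f : H → J) :
    ∫ ω, ∏ h, Y (f h) ω ∂μ =
      Nat.card {m : H → H // IsPerfectMatching m ∧ ∀ h, f (m h) = f h} := by
  classical
  -- `J` may be infinite, so only the variables that occur are kept before factoring the
  -- expectation.
  let J' := Set.range f
  let f' : H → J' := Set.rangeFactorization f
  have : Fintype J' := Fintype.ofFinite _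
  have hind' : iIndepFun (fun j : J' => Y j) μ := hind.precomp Subtype.val_injective
  have h1 (ω : Ω) : ∏ h, Y (f h) ω = ∏ j : J', (Y j ω) ^ Fintype.card {h // f' h = j} := by
    refine (Finset.prod_fiberwise' Finset.univ f' (fun j => Y j ω)).symm.trans ?_
    refine Finset.prod_congr rfl fun j _ => ?_
    rw [Finset.prod_const, Fintype.card_subtype]
  simp only [h1]
  rw [hind'.integral_fun_prod_comp (f := fun j x => x ^ Fintype.card {h // f' h = j})
    (fun j => (hY j).aemeasurable) (fun j => by fun_prop)]
  have h2 : Nat.card {m : H → H // IsPerfectMatching m ∧ ∀ h, f (m h) = f h} =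
      Nat.card {m : H → H // IsPerfectMatching m ∧ ∀ h, f' (m h) = f' h} :=
    Nat.card_congr (Equiv.subtypeEquivRight fun m => and_congr_right' (forall_congr' fun h =>
      (Subtype.ext_iff (a1 := f' (m h)) (a2 := f' h)).symm))
  rw [h2, Nat.card_congr (perfectMatchingFiberEquiv f'), Nat.card_pi, Nat.cast_prod]
  refine Finset.prod_congr rfl fun j _ => ?_
  rw [← integral_pow_gaussianReal, ← (hY j).map_eq, integral_map (hY j).aemeasurable
    (by fun_prop)]

theorem integrable_prod_of_hasLaw_gaussianReal {Ω H J : Type*} [MeasurableSpace Ω]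
    {μ : Measure Ω} [Fintype H] {Y : J → Ω → ℝ}
    (hY : ∀ j, HasLaw (Y j) (gaussianReal 0 1) μ) (hind : iIndepFun Y μ) (f : H → J) :
    Integrable (fun ω => ∏ h, Y (f h) ω) μ := by
  have := hind.isProbabilityMeasure
  -- Hölder with all exponents equal to the number of factors: the resulting exponent is 1, or ∞ for
  -- the empty product.
  refine MemLp.integrable (q := (∑ h : H, (Fintype.card H : ENNReal)⁻¹)⁻¹) ?_ ?_
  · simp only [Finset.sum_const, Finset.card_univ, nsmul_eq_mul]
    exact ENNReal.one_le_inv.2 (ENNReal.mul_inv_le_one _)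
  · refine MemLp.prod' (p := fun _ => (Fintype.card H : ENNReal)) fun h _ => ?_
    have h1 := memLp_id_gaussianReal' (μ := 0) (v := 1) (Fintype.card H : ENNReal) (by simp)
    rw [← (hY (f h)).map_eq] at h1
    exact h1.comp_of_map (hY (f h)).aemeasurable

/-! ### Quaternions as complex matrices and traces of words -/

/-- The entries of the `2 × 2` complex matrix representing a quaternion. -/
noncomputable def quaternionEntry (q : ℍ[ℝ]) : Bool → Bool → ℂ
  | false, false => q.re + q.imI * Complex.I
  | false, true => q.imJ + q.imK * Complex.I
  | true, false => -q.imJ + q.imK * Complex.I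
  | true, true => q.re - q.imI * Complex.I

/-- The representation of the quaternions by `2 × 2` complex matrices. -/
noncomputable def quaternionMatrix : ℍ[ℝ] →* Matrix Bool Bool ℂ where
  toFun q := Matrix.of (quaternionEntry q)
  map_one' := by
    ext a b; cases a <;> cases b <;> simp [quaternionEntry]
  map_mul' p q := by
    ext a b; cases a <;> cases b <;> simp [quaternionEntry, Matrix.mul_apply] <;>
      ring_nf <;> simp <;> ring

theorem trace_quaternionMatrix (q : ℍ[ℝ]) : (quaternionMatrix q).trace = 2 * (q.re : ℂ) := by
  simp [Matrix.trace, quaternionMatrix, quaternionEntry]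
  ring

/-- The matrix entries of the conjugated (for `η = true`) or unconjugated basis quaternions. -/
noncomputable def basisEntry (η : Bool) (c : Fin 4) (a b : Bool) : ℂ :=
  let e : ℍ[ℝ] := ![⟨1, 0, 0, 0⟩, ⟨0, 1, 0, 0⟩, ⟨0, 0, 1, 0⟩, ⟨0, 0, 0, 1⟩] c
  quaternionEntry (if η then star e else e) a b

theorem quaternionMatrix_apply_eq_sum (η : Bool) (q : ℍ[ℝ]) (a b : Bool) :
    quaternionMatrix (if η then star q else q) a b =
      ∑ c, basisEntry η c a b * (quaternionCoord q c : ℂ) := by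
  cases η <;> cases a <;> cases b <;>
    simp [quaternionMatrix, basisEntry, quaternionEntry, quaternionCoord, Fin.sum_univ_succ] <;>
    ring

/-- The weight of the two sides of a ribbon in the state sum over colourings of the sides: `a`, `b`
are the colours of the sides at one end, `a'`, `b'` those at the other end. -/
def ribbonWeight (tw : Bool) (a b a' b' : Bool) : ℤ :=
  if tw then (if a' = !a ∧ b' = !b then (if a = b then 1 else -1) else 0)
  else (if b' = a ∧ a' = b then 1 else 0)

/-- The left side is the covariance of two entries of a Gaussian quaternion or its conjugate. The 2
is the mean square modulus of an entry; the minus sign of a twisted ribbon comes from the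
off-diagonal entries being β and -β̄. -/
theorem sum_basisEntry_mul_basisEntry (η η' a b a' b' : Bool) :
    ∑ c, basisEntry η c a b * basisEntry η' c a' b' =
      2 * (ribbonWeight (η == η') a b a' b' : ℂ) := by
  cases η <;> cases η' <;> cases a <;> cases b <;> cases a' <;> cases b' <;>
    simp [basisEntry, quaternionEntry, ribbonWeight, Fin.sum_univ_succ] <;> norm_num

theorem Matrix.list_prod_ofFn_apply {R β : Type*} [CommRing R] [Fintype β] [DecidableEq β]
    (n : ℕ) (A : Fin n → Matrix β β R) (x y : β) :
    (List.ofFn A).prod x y = ∑ g : Fin n → β,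
      (if (Fin.cons x g : Fin (n + 1) → β) (Fin.last n) = y then 1 else 0) *
        ∏ j, A j ((Fin.cons x g : Fin (n + 1) → β) j.castSucc) (g j) := by
  induction n generalizing x with
  | zero => simp [Matrix.one_apply]
  | succ n ih =>
    rw [List.ofFn_succ, List.prod_cons, Matrix.mul_apply,
      ← (Fin.consEquiv (fun _ : Fin (n + 1) => β)).sum_comp, Fintype.sum_prod_type]
    refine Finset.sum_congr rfl fun z _ => ?_
    rw [ih, Finset.mul_sum]
    refine Finset.sum_congr rfl fun g _ => ?_
    have h1 : (Fin.last (n + 1)) = (Fin.last n).succ := rfl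
    rw [Fin.prod_univ_succ, h1]
    simp only [Fin.consEquiv_apply, Fin.cons_succ, Fin.castSucc_zero, Fin.cons_zero,
      ← Fin.succ_castSucc]
    ring

/-- Here `g j` is the column index of the `j`-th factor, hence the row index of the next one
cyclically. The empty word is exceptional: its trace is that of the identity, while the sum over the
single empty assignment is 1. -/
theorem Matrix.trace_list_prod_ofFn {R β : Type*} [CommRing R] [Fintype β] [DecidableEq β]
    (n : ℕ) (A : Fin n → Matrix β β R) :
    (List.ofFn A).prod.trace = (if n = 0 then (Fintype.card β : R) else 1) *
      ∑ g : Fin n → β, ∏ j, A j (g ((finRotate n).symm j)) (g j) := by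
  rcases n with _ | n
  · simp [Matrix.trace]
  · simp only [Matrix.trace, Matrix.diag_apply, Matrix.list_prod_ofFn_apply]
    rw [Finset.sum_comm, if_neg (Nat.succ_ne_zero n), one_mul]
    refine Finset.sum_congr rfl fun g _ => ?_
    have h1 : (Fin.last (n + 1)) = (Fin.last n).succ := rfl
    simp only [h1, Fin.cons_succ, ite_mul, one_mul, zero_mul, Finset.sum_ite_eq,
      Finset.mem_univ, if_true]
    refine Finset.prod_congr rfl fun j _ => ?_
    congr 1
    refine Fin.cases ?_ (fun i => ?_) j
    · have : (finRotate (n + 1)).symm 0 = Fin.last n := by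
        rw [Equiv.symm_apply_eq, finRotate_last]
      rw [this]; rfl
    · have : (finRotate (n + 1)).symm i.succ = i.castSucc := by
        rw [Equiv.symm_apply_eq, finRotate_apply, Fin.coeSucc_eq_succ]
      rw [this, ← Fin.succ_castSucc, Fin.cons_succ]

/-! ### Permutations of a colour class -/

/-- The permutation `a ∘ b` of one colour class of a set coloured so that the involutions `a` and
`b` both exchange the two colours. -/
def colorPerm {S : Type*} {t : S → Bool} {a b : S → S} (ha : Function.Involutive a)
    (hb : Function.Involutive b) (hat : ∀ x, t (a x) = !t x) (hbt : ∀ x, t (b x) = !t x) :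
    Equiv.Perm {x // t x = true} where
  toFun x := ⟨a (b x), by simp [hat, hbt, x.2]⟩
  invFun x := ⟨b (a x), by simp [hat, hbt, x.2]⟩
  left_inv x := Subtype.ext (by simp [ha _, hb _])
  right_inv x := Subtype.ext (by simp [ha _, hb _])

theorem two_mul_card_color_eq {S : Type*} [Fintype S] {t : S → Bool} {a : S → S}
    (ha : Function.Involutive a) (hat : ∀ x, t (a x) = !t x) :
    2 * Fintype.card {x // t x = true} = Fintype.card S := by
  classical
  rw [← Fintype.card_congr (Equiv.sumCompl fun x => t x = true), Fintype.card_sum, two_mul]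
  congr 1
  exact Fintype.card_congr (ha.toPerm.subtypeEquiv fun x => by simp [hat])

/-- The cycles of `a ∘ b` on a colour class are the connected components of the graph with
edges `x — a x` and `x — b x`. -/
theorem card_sameCycle_colorPerm {S : Type*} {t : S → Bool} {a b : S → S}
    (ha : Function.Involutive a)
    (hb : Function.Involutive b) (hat : ∀ x, t (a x) = !t x) (hbt : ∀ x, t (b x) = !t x)
    (r : S → S → Prop) (hr : ∀ x y, r x y → y = a x ∨ y = b x)
    (hra : ∀ x, Quot.mk r (a x) = Quot.mk r x) (hrb : ∀ x, Quot.mk r (b x) = Quot.mk r x) :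
    Nat.card (Quotient (Equiv.Perm.SameCycle.setoid (colorPerm ha hb hat hbt))) =
      Nat.card (Quot r) := by
  set σ := colorPerm ha hb hat hbt with hσ
  have hcoe (x : {x // t x = true}) : (σ x : S) = a (b x) := rfl
  have hstep (x : {x // t x = true}) : Quot.mk r (σ x).1 = Quot.mk r x.1 := by
    rw [hcoe, hra, hrb]
  have hpow (k : ℤ) (x : {x // t x = true}) : Quot.mk r ((σ ^ k) x).1 = Quot.mk r x.1 := by
    induction k with
    | zero => simp
    | succ k ih => rw [add_comm, zpow_one_add, Equiv.Perm.mul_apply, hstep, ih]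
    | pred k ih =>
      rw [← ih, show (-(k : ℤ)) = 1 + (-k - 1) by ring, zpow_one_add, Equiv.Perm.mul_apply, hstep]
      congr 4
      ring
  let F : Quotient (Equiv.Perm.SameCycle.setoid σ) → Quot r :=
    Quotient.lift (fun x => Quot.mk r x.1) (by
      rintro x y ⟨k, rfl⟩
      exact (hpow k x).symm)
  -- A point of the other colour is represented by its `a`-neighbour, which lies in the chosen
  -- class.
  let proj (x : S) : Quotient (Equiv.Perm.SameCycle.setoid σ) :=
    if hx : t x = true then Quotient.mk _ ⟨x, hx⟩ else Quotient.mk _ ⟨a x, by simp [hat, hx]⟩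
  have hproja (x : S) : proj (a x) = proj x := by
    by_cases hx : t x = true
    · simp [proj, hat, hx, ha x]
    · simp [proj, hat, hx]
  have hprojb' (x : S) (hx : t x = true) : proj (b x) = proj x := by
    have h1 : ¬ t (b x) = true := by simp [hbt, hx]
    simp only [proj, hx, h1, dif_pos]
    exact Quotient.sound (Equiv.Perm.SameCycle.symm ⟨1, by rw [zpow_one]; rfl⟩)
  have hprojb (x : S) : proj (b x) = proj x := by
    by_cases hx : t x = true
    · exact hprojb' x hx
    · rw [← hprojb' (b x) (by simp [hbt, hx]), hb x]
  let G : Quot r → Quotient (Equiv.Perm.SameCycle.setoid σ) := Quot.lift proj (by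
    intro x y h
    rcases hr x y h with rfl | rfl
    · exact (hproja x).symm
    · exact (hprojb x).symm)
  refine Nat.card_congr ⟨F, G, fun q => ?_, fun q => ?_⟩
  · induction q using Quotient.inductionOn with
    | h x => simp [F, G, proj, x.2]
  · induction q using Quot.inductionOn with
    | h x =>
      by_cases hx : t x = true
      · simp [F, G, proj, hx]
      · simp [F, G, proj, hx, hra]

theorem Equiv.Perm.sign_of_sq_eq_one_of_card_support {α : Type*} [Fintype α] [DecidableEq α]
    {σ : Equiv.Perm α} (hσ : σ ^ 2 = 1) {k : ℕ} (hk : σ.support.card = 2 * k) :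
    Equiv.Perm.sign σ = (-1) ^ k := by
  rw [Equiv.Perm.sign_of_pow_two_eq_one hσ, Equiv.Perm.card_fixedPoints,
    Equiv.Perm.sum_cycleType, Nat.sub_sub_self (Finset.card_le_univ _), hk]
  simp

/-- The hypothesis on `R` says that it contains exactly one end of every pair; such an `R` stands
for the set of ribbons below. -/
theorem card_filter_eq_two_mul {H : Type*} [Fintype H] {m : H → H}
    (hm : Function.Involutive m) {R : Finset H} (hR : ∀ h, m h ∈ R ↔ h ∉ R) (p : H → Prop)
    [DecidablePred p] (hp : ∀ h, p (m h) ↔ p h) :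
    (Finset.univ.filter p).card = 2 * (R.filter p).card := by
  classical
  have h1 : (Finset.univ.filter p) = R.filter p ∪ (R.filter p).image m := by
    ext h
    simp only [Finset.mem_filter, Finset.mem_univ, true_and, Finset.mem_union, Finset.mem_image]
    constructor
    · intro h2
      by_cases h3 : h ∈ R
      · exact Or.inl ⟨h3, h2⟩
      · exact Or.inr ⟨m h, ⟨(hR h).2 h3, (hp h).2 h2⟩, hm h⟩
    · rintro (h2 | ⟨x, hx, rfl⟩)
      · exact h2.2
      · exact (hp x).2 hx.2
  rw [h1, Finset.card_union_of_disjoint, Finset.card_image_of_injective _ hm.injective, two_mul]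
  rw [Finset.disjoint_left]
  intro h h2 h3
  simp only [Finset.mem_filter, Finset.mem_image] at h2 h3
  obtain ⟨x, hx, rfl⟩ := h3
  exact (hR x).1 h2.1 hx.1

/-! ### Sign of the boundary permutation of a ribbon surface -/

section RibbonSurface

variable {H : Type*}

/-- The side following or preceding a given one along the boundary of a vertex disk, when `next`
rotates the half-edges at each vertex. -/
def cornerMate (next : Equiv.Perm H) : H × Bool → H × Bool
  | (h, true) => (next h, false)
  | (h, false) => (next.symm h, true)

/-- The other end of a side of a ribbon. -/
def ribbonMate (m : H → H) (tw : H → Bool) (x : H × Bool) : H × Bool :=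
  (m x.1, if tw x.1 then x.2 else !x.2)

/-- The colouring of sides induced by a colouring of the corners. -/
def sideColor (next : Equiv.Perm H) (g : H → Bool) (x : H × Bool) : Bool :=
  if x.2 then g x.1 else g (next.symm x.1)

/-- A colouring of the corners is admissible if untwisted ribbons preserve and twisted ribbons
exchange the colours of the sides. -/
def AdmissibleColoring (next : Equiv.Perm H) (m : H → H) (tw : H → Bool) (g : H → Bool) : Prop :=
  ∀ x, sideColor next g (ribbonMate m tw x) = xor (tw x.1) (sideColor next g x)

theorem isPerfectMatching_cornerMate (next : Equiv.Perm H) :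
    IsPerfectMatching (cornerMate next) := by
  constructor
  · rintro ⟨h, _ | _⟩ <;> simp [cornerMate]
  · rintro ⟨h, _ | _⟩ <;> simp [cornerMate]

theorem isPerfectMatching_ribbonMate {m : H → H} (hm : IsPerfectMatching m) {tw : H → Bool}
    (htw : ∀ h, tw (m h) = tw h) : IsPerfectMatching (ribbonMate m tw) := by
  constructor
  · rintro ⟨h, b⟩
    cases ht : tw h <;> simp [ribbonMate, ht, htw, hm.invol h]
  · rintro ⟨h, b⟩ h1
    exact hm.ne h (congrArg Prod.fst h1)

theorem sideColor_cornerMate (next : Equiv.Perm H) (g : H → Bool) (x : H × Bool) :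
    sideColor next g (cornerMate next x) = sideColor next g x := by
  obtain ⟨h, _ | _⟩ := x <;> simp [cornerMate, sideColor]

theorem xor_sideColor_cornerMate (next : Equiv.Perm H) (g : H → Bool) (x : H × Bool) :
    xor (sideColor next g (cornerMate next x)) (cornerMate next x).2 =
      !(xor (sideColor next g x) x.2) := by
  rw [sideColor_cornerMate]
  obtain ⟨h, _ | _⟩ := x <;> simp [cornerMate]

theorem xor_sideColor_ribbonMate {next : Equiv.Perm H} {m : H → H} {tw : H → Bool} {g : H → Bool}
    (hg : AdmissibleColoring next m tw g) (x : H × Bool) :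
    xor (sideColor next g (ribbonMate m tw x)) (ribbonMate m tw x).2 =
      !(xor (sideColor next g x) x.2) := by
  rw [hg x]
  cases h : tw x.1 <;> simp [ribbonMate, h]

/-- An auxiliary involution `w` of the sides is inserted between corners and ribbons. "Corner after
`w`" then becomes, up to inverting one part, a permutation of the half-edges themselves, and "`w`
after ribbon" is a product of disjoint transpositions, so both signs can be read off. -/
theorem sign_colorPerm_mul_sign_next [Fintype H] [DecidableEq H] (next : Equiv.Perm H)
    {m : H → H} (hm : IsPerfectMatching m) {tw : H → Bool} (htw : ∀ h, tw (m h) = tw h)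
    {g : H → Bool} (hg : AdmissibleColoring next m tw g)
    {R : Finset H} (hR : ∀ h, m h ∈ R ↔ h ∉ R) :
    Equiv.Perm.sign (colorPerm (t := fun x => xor (sideColor next g x) x.2)
      (isPerfectMatching_cornerMate next).invol (isPerfectMatching_ribbonMate hm htw).invol
      (xor_sideColor_cornerMate next g) (xor_sideColor_ribbonMate hg)) * Equiv.Perm.sign next =
    (-1) ^ (R.card + (R.filter fun h => tw h = true ∧ g (next.symm h) ≠ g h).card) := by
  let t : H × Bool → Bool := fun x => xor (sideColor next g x) x.2
  let a : H → Bool := fun h => g (next.symm h)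
  have hsF (h : H) : sideColor next g (h, false) = a h := rfl
  have hsT (h : H) : sideColor next g (h, true) = g h := rfl
  let C : H → Prop := fun h => tw h = false ∨ a h ≠ g h
  have hunt (h : H) (h1 : tw h = false) : a (m h) = g h ∧ g (m h) = a h := by
    have h2 := hg (h, true)
    have h3 := hg (h, false)
    simp [ribbonMate, h1, hsF, hsT] at h2 h3
    exact ⟨h2, h3⟩
  have htwi (h : H) (h1 : tw h = true) : a (m h) = !a h ∧ g (m h) = !g h := by
    have h2 := hg (h, true)
    have h3 := hg (h, false)
    simp [ribbonMate, h1, hsF, hsT] at h2 h3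
    exact ⟨h3, h2⟩
  have hbadm (h : H) (h1 : tw h = true) : a (m h) ≠ g (m h) ↔ a h ≠ g h := by
    rw [(htwi h h1).1, (htwi h h1).2]; simp
  have hCm (h : H) : C (m h) ↔ C h := by
    simp only [C, htw]
    cases h1 : tw h
    · simp
    · simpa using hbadm h h1
  -- `n0` is chosen to exchange the colours of the two sides of a half-edge. The mate does so if the
  -- ribbon is untwisted, or if it is twisted with different colours (negating both swaps them);
  -- with equal colours the identity does.
  let n0 : H → H := fun h => if C h then m h else h
  have hn0C (h : H) (hC : C h) : n0 h = m h := if_pos hC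
  have hn0C' (h : H) (hC : ¬ C h) : n0 h = h := if_neg hC
  have hn0i : Function.Involutive n0 := by
    intro h
    by_cases hC : C h
    · rw [hn0C h hC, hn0C _ ((hCm h).2 hC), hm.invol]
    · rw [hn0C' h hC, hn0C' h hC]
  have htwn0 (h : H) : tw (n0 h) = tw h := by
    by_cases hC : C h
    · rw [hn0C h hC, htw]
    · rw [hn0C' h hC]
  have hn0m (h : H) : n0 (m h) = m (n0 h) := by
    by_cases hC : C h
    · rw [hn0C h hC, hn0C _ ((hCm h).2 hC)]
    · rw [hn0C' h hC, hn0C' _ (fun h1 => hC ((hCm h).1 h1))]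
  have hn0g (h : H) : a (n0 h) = g h ∧ g (n0 h) = a h := by
    by_cases hC : C h
    · rw [hn0C h hC]
      cases h1 : tw h
      · exact hunt h h1
      · rw [(htwi h h1).1, (htwi h h1).2]
        have h2 : a h ≠ g h := by simpa [C, h1] using hC
        revert h2
        cases a h <;> cases g h <;> simp
    · rw [hn0C' h hC]
      have h2 : a h = g h := by
        by_contra h3
        exact hC (Or.inr h3)
      exact ⟨h2, h2.symm⟩
  let w : H × Bool → H × Bool := fun x => (n0 x.1, !x.2)
  have hw : Function.Involutive w := fun x => by simp [w, hn0i x.1]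
  have hwt (x : H × Bool) : t (w x) = !t x := by
    obtain ⟨h, _ | _⟩ := x
    · simp [t, w, hsF, hsT, hn0g]
    · simp [t, w, hsF, hsT, hn0g]
  have hprod : colorPerm (t := t)
      (isPerfectMatching_cornerMate next).invol (isPerfectMatching_ribbonMate hm htw).invol
      (xor_sideColor_cornerMate next g) (xor_sideColor_ribbonMate hg) =
      colorPerm (t := t) (isPerfectMatching_cornerMate next).invol hw
        (xor_sideColor_cornerMate next g) hwt *
      colorPerm (t := t) hw (isPerfectMatching_ribbonMate hm htw).invol hwt
        (xor_sideColor_ribbonMate hg) := by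
    ext1 x
    refine Subtype.ext ?_
    change cornerMate next _ = cornerMate next (w (w _))
    rw [hw]
  -- In the class `t = true` lie the first sides coloured `true` and the second sides coloured
  -- `false`. Moving the latter by `n0` makes them fill exactly the half-edges with `a h = false`.
  let e : {x // t x = true} ≃ H :=
    { toFun := fun x => if x.1.2 then n0 x.1.1 else x.1.1
      invFun := fun h => if ha : a h = true then ⟨(h, false), by simpa [t, hsF] using ha⟩
        else ⟨(n0 h, true), by simpa [t, hsT, hn0g] using ha⟩
      left_inv := by
        rintro ⟨⟨h, _ | _⟩, hx⟩
        · have : a h = true := by simpa [t, hsF] using hx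
          simp [this]
        · have : a (n0 h) = false := by rw [(hn0g h).1]; simpa [t, hsT] using hx
          simp [this, hn0i h]
      right_inv := by
        intro h
        by_cases ha : a h = true
        · simp [ha]
        · simp [ha, hn0i h] }
  have hetw (x : {x // t x = true}) : tw (e x) = tw x.1.1 := by
    obtain ⟨⟨h, _ | _⟩, hx⟩ := x
    · rfl
    · exact htwn0 h
  let n0p : Equiv.Perm H := hn0i.toPerm
  let ρ : Equiv.Perm H := next * n0p
  have haρ (h : H) : a (ρ h) = a h := by
    change g (next.symm (next (n0 h))) = a h
    rw [Equiv.symm_apply_apply, (hn0g h).2]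
  let ρ1 : Equiv.Perm {h // a h = true} := ρ.subtypePerm (by simp [haρ])
  let ρ2 : Equiv.Perm {h // ¬ a h = true} := ρ.subtypePerm (by simp [haρ])
  have hsρ : Equiv.Perm.sign ρ = Equiv.Perm.sign ρ1 * Equiv.Perm.sign ρ2 := by
    rw [← Equiv.Perm.sign_subtypeCongr]
    congr 1
    ext h
    by_cases ha : a h = true
    · rw [Equiv.Perm.subtypeCongr.left_apply ρ1 ρ2 ha]; rfl
    · rw [Equiv.Perm.subtypeCongr.right_apply ρ1 ρ2 ha]; rfl
  -- Under `e` the permutation becomes `ρ` where `a` is true and `ρ⁻¹` elsewhere; inverting a block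
  -- does not change the sign.
  have hsign1 : Equiv.Perm.sign (colorPerm (t := t) (isPerfectMatching_cornerMate next).invol hw
        (xor_sideColor_cornerMate next g) hwt) = Equiv.Perm.sign ρ := by
    rw [hsρ, ← Equiv.Perm.sign_inv ρ2, ← Equiv.Perm.sign_subtypeCongr]
    refine Equiv.Perm.sign_eq_sign_of_equiv _ _ e ?_
    rintro ⟨⟨h, _ | _⟩, hx⟩
    · have ha : a h = true := by simpa [t, hsF] using hx
      exact (Equiv.Perm.subtypeCongr.left_apply ρ1 ρ2⁻¹ ha).symm
    · have ha : ¬ a (n0 h) = true := by rw [(hn0g h).1]; simpa [t, hsT] using hx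
      exact (Equiv.Perm.subtypeCongr.right_apply ρ1 ρ2⁻¹ ha).symm
  -- On untwisted ribbons `w` undoes the ribbon move; twisted ones give fixed-point-free
  -- involutions, hence one transposition per twisted ribbon.
  have hsign2 : Equiv.Perm.sign (colorPerm (t := t) hw
      (isPerfectMatching_ribbonMate hm htw).invol hwt (xor_sideColor_ribbonMate hg)) =
      (-1) ^ (R.filter fun h => tw h = true).card := by
    refine Equiv.Perm.sign_of_sq_eq_one_of_card_support ?_ ?_
    · ext1 x
      refine Subtype.ext ?_
      obtain ⟨⟨h, b⟩, hx⟩ := x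
      change w (ribbonMate m tw (w (ribbonMate m tw (h, b)))) = (h, b)
      cases h1 : tw h <;>
        simp [w, ribbonMate, h1, htw, htwn0, hn0m, hm.invol _, hn0i _]
    · rw [← card_filter_eq_two_mul hm.invol hR (fun h => tw h = true) (by simp [htw])]
      refine Finset.card_equiv e fun x => ?_
      rw [Equiv.Perm.mem_support, Finset.mem_filter, hetw, ne_eq, Subtype.ext_iff]
      obtain ⟨⟨h, b⟩, hx⟩ := x
      change ¬ (w (ribbonMate m tw (h, b)) = (h, b)) ↔ _
      cases h1 : tw h
      · have : C h := Or.inl h1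
        simp [w, ribbonMate, h1, hn0m, hn0C h this, hm.invol h]
      · simp [w, ribbonMate, h1]
  have hsign3 : Equiv.Perm.sign n0p =
      (-1) ^ (R.filter C).card := by
    refine Equiv.Perm.sign_of_sq_eq_one_of_card_support ?_ ?_
    · ext h; exact hn0i h
    · rw [← card_filter_eq_two_mul hm.invol hR C hCm]
      congr 1
      ext h
      rw [Equiv.Perm.mem_support, Finset.mem_filter]
      change n0 h ≠ h ↔ _
      by_cases hC : C h
      · simp [hn0C h hC, hm.ne h, hC]
      · simp [hn0C' h hC, hC]
  -- Every ribbon is twisted or in `C`, and it is both exactly when it is twisted with differently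
  -- coloured sides.
  have hcard : (R.filter fun h => tw h = true).card + (R.filter C).card =
      R.card + (R.filter fun h => tw h = true ∧ g (next.symm h) ≠ g h).card := by
    rw [← Finset.card_union_add_card_inter, ← Finset.filter_or, ← Finset.filter_and]
    congr 2
    · refine Finset.filter_true_of_mem fun h _ => ?_
      cases h1 : tw h <;> simp [C, h1]
    · refine Finset.filter_congr fun h _ => ?_
      cases h1 : tw h <;> simp [C, h1, a]
  rw [← hcard, pow_add, ← hsign2, ← hsign3, hprod, map_mul, hsign1]
  simp only [ρ, map_mul]
  have := Int.units_mul_self (Equiv.Perm.sign next)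
  rw [mul_right_comm, mul_right_comm (Equiv.Perm.sign next), this, one_mul, mul_comm]

end RibbonSurface

/-! ### The state sum over corner colourings -/

section StateSum

variable {H : Type*} {m : H → H} {tw : H → Bool}

/-- A common two-colouring `t` of the corner and ribbon matchings serves as reference. Crossing a
corner or a ribbon flips an even number among `t`, the side bit and the colour, so their xor is
constant on boundary cycles and can be prescribed freely there. -/
theorem card_admissibleColoring [Finite H] (next : Equiv.Perm H)
    (hm : IsPerfectMatching m) (htw : ∀ h, tw (m h) = tw h) (r : H × Bool → H × Bool → Prop)
    (hr : ∀ x y, r x y → y = cornerMate next x ∨ y = ribbonMate m tw x)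
    (hra : ∀ x, Quot.mk r (cornerMate next x) = Quot.mk r x)
    (hrb : ∀ x, Quot.mk r (ribbonMate m tw x) = Quot.mk r x) :
    Nat.card {g : H → Bool // AdmissibleColoring next m tw g} = 2 ^ Nat.card (Quot r) := by
  obtain ⟨t, hta, htb⟩ := (isPerfectMatching_cornerMate next).exists_common_coloring
    (isPerfectMatching_ribbonMate hm htw)
  have hside (s : H × Bool → Bool) (hs : ∀ x, s (cornerMate next x) = s x) (x : H × Bool) :
      sideColor next (fun h => s (h, true)) x = s x := by
    obtain ⟨h, _ | _⟩ := x
    · exact hs (h, false)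
    · rfl
  have hcorner (x : H × Bool) : (cornerMate next x).2 = !x.2 := by
    obtain ⟨h, _ | _⟩ := x <;> rfl
  have hribbon (x : H × Bool) : (ribbonMate m tw x).2 = xor (!x.2) (tw x.1) := by
    cases h : tw x.1 <;> simp [ribbonMate, h]
  let S (f : Quot r → Bool) (x : H × Bool) : Bool := xor (xor (t x) x.2) (f (Quot.mk r x))
  have hSa (f : Quot r → Bool) (x : H × Bool) : S f (cornerMate next x) = S f x := by
    simp [S, hra, hta, hcorner]
  have hSb (f : Quot r → Bool) (x : H × Bool) :
      S f (ribbonMate m tw x) = xor (tw x.1) (S f x) := by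
    simp only [S, hrb, htb, hribbon]
    cases t x <;> cases x.2 <;> cases tw x.1 <;> simp
  let F (g : H → Bool) (x : H × Bool) : Bool := xor (xor (t x) x.2) (sideColor next g x)
  have hF (g : H → Bool) (hg : AdmissibleColoring next m tw g) (x y : H × Bool) (h : r x y) :
      F g x = F g y := by
    rcases hr x y h with rfl | rfl
    · simp [F, hta, hcorner, sideColor_cornerMate]
    · simp only [F, htb, hribbon, hg x]
      cases t x <;> cases x.2 <;> cases tw x.1 <;> simp
  have e : {g : H → Bool // AdmissibleColoring next m tw g} ≃ (Quot r → Bool) :=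
    { toFun := fun g => Quot.lift (F g.1) (hF g.1 g.2)
      invFun := fun f => ⟨fun h => S f (h, true), fun x => by
        rw [hside _ (hSa f), hside _ (hSa f), hSb]⟩
      left_inv := by
        rintro ⟨g, hg⟩
        ext h
        simp [S, F, sideColor]
      right_inv := by
        intro f
        ext q
        induction q using Quot.inductionOn with
        | h x =>
          simp only [F, hside _ (hSa f), S]
          cases t x <;> cases x.2 <;> simp }
  rw [Nat.card_congr e, Nat.card_fun, Nat.card_eq_fintype_card, Fintype.card_bool]

theorem prod_ribbonWeight (next : Equiv.Perm H)
    (hm : IsPerfectMatching m) (htw : ∀ h, tw (m h) = tw h) {R : Finset H}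
    (hR : ∀ h, m h ∈ R ↔ h ∉ R) (g : H → Bool) [Decidable (AdmissibleColoring next m tw g)] :
    ∏ h ∈ R, ribbonWeight (tw h) (g (next.symm h)) (g h) (g (next.symm (m h))) (g (m h)) =
      if AdmissibleColoring next m tw g then
        (-1) ^ (R.filter fun h => tw h = true ∧ g (next.symm h) ≠ g h).card else 0 := by
  classical
  let p : H → Prop := fun h => ∀ b,
    sideColor next g (ribbonMate m tw (h, b)) = xor (tw h) (sideColor next g (h, b))
  have hp (h : H) (h1 : p h) : p (m h) := by
    intro b
    have h2 := h1 true
    have h3 := h1 false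
    cases b <;> cases ht : tw h <;> simp_all [ribbonMate, sideColor, hm.invol h]
  have hAp : AdmissibleColoring next m tw g ↔ ∀ h ∈ R, p h := by
    constructor
    · intro h1 h _ b
      exact h1 (h, b)
    · rintro h1 ⟨h, b⟩
      by_cases hh : h ∈ R
      · exact h1 h hh b
      · have := hp _ (h1 (m h) ((hR h).2 hh))
        rw [hm.invol] at this
        exact this b
  have hw (h : H) :
      ribbonWeight (tw h) (g (next.symm h)) (g h) (g (next.symm (m h))) (g (m h)) =
      if p h then (if tw h = true ∧ g (next.symm h) ≠ g h then -1 else 1) else 0 := by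
    simp only [p, Bool.forall_bool, ribbonMate, sideColor, ribbonWeight]
    cases tw h <;> cases g (next.symm h) <;> cases g h <;> cases g (next.symm (m h)) <;>
      cases g (m h) <;> rfl
  simp only [hw, hAp]
  by_cases h1 : ∀ h ∈ R, p h
  · rw [if_pos h1, Finset.prod_congr rfl fun h hh => if_pos (h1 h hh), Finset.prod_ite,
      Finset.prod_const, Finset.prod_const_one, mul_one]
  · rw [if_neg h1]
    push Not at h1
    obtain ⟨h, hh, h2⟩ := h1
    exact Finset.prod_eq_zero hh (if_neg h2)

theorem sum_prod_ribbonWeight [Fintype H] [DecidableEq H] (next : Equiv.Perm H)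
    (hm : IsPerfectMatching m) (htw : ∀ h, tw (m h) = tw h) (r : H × Bool → H × Bool → Prop)
    (hr : ∀ x y, r x y → y = cornerMate next x ∨ y = ribbonMate m tw x)
    (hra : ∀ x, Quot.mk r (cornerMate next x) = Quot.mk r x)
    (hrb : ∀ x, Quot.mk r (ribbonMate m tw x) = Quot.mk r x) {R : Finset H}
    (hR : ∀ h, m h ∈ R ↔ h ∉ R) :
    ∑ g : H → Bool, ∏ h ∈ R,
        ribbonWeight (tw h) (g (next.symm h)) (g h) (g (next.symm (m h))) (g (m h)) =
      (-2) ^ Nat.card (Quot r) * (-1) ^ R.card * (Equiv.Perm.sign next : ℤ) := by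
  classical
  have hRcard : Fintype.card H = 2 * R.card := by
    have := card_filter_eq_two_mul hm.invol hR (fun _ => True) (by simp)
    simpa using this
  have hterm (g : H → Bool) (hg : AdmissibleColoring next m tw g) :
      (-1 : ℤ) ^ (R.filter fun h => tw h = true ∧ g (next.symm h) ≠ g h).card =
        (-1) ^ Nat.card (Quot r) * (-1) ^ R.card * (Equiv.Perm.sign next : ℤ) := by
    have h1 := sign_colorPerm_mul_sign_next next hm htw hg hR
    rw [Equiv.Perm.sign_eq_neg_one_pow_card_add_card_sameCycle,
      card_sameCycle_colorPerm _ _ _ _ r hr hra hrb] at h1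
    -- The colour class is half of the 4|R| sides, so its size is even and drops out of the sign.
    have h2 := two_mul_card_color_eq
      (t := fun x => xor (sideColor next g x) x.2) (isPerfectMatching_cornerMate next).invol
      (xor_sideColor_cornerMate next g)
    rw [Fintype.card_prod, Fintype.card_bool, hRcard] at h2
    rw [show Fintype.card {x // xor (sideColor next g x) x.2 = true} = 2 * R.card by omega,
      pow_add, pow_mul, pow_add] at h1
    have h3 := congrArg (fun u : ℤˣ => (u : ℤ)) h1
    simp only [neg_one_sq, one_pow, one_mul, Units.val_mul, Units.val_pow_eq_pow_val,
      Units.val_neg, Units.val_one] at h3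
    have h4 : ((-1 : ℤ) ^ R.card) * (-1) ^ R.card = 1 := by
      rw [← mul_pow]; simp
    linear_combination -(-1 : ℤ) ^ R.card * h3 -
      (-1 : ℤ) ^ (R.filter fun h => tw h = true ∧ g (next.symm h) ≠ g h).card * h4
  simp only [prod_ribbonWeight next hm htw hR]
  rw [← Finset.sum_filter, Finset.sum_congr rfl fun g hg => hterm g (Finset.mem_filter.1 hg).2,
    Finset.sum_const, ← Fintype.card_subtype, ← Nat.card_eq_fintype_card,
    card_admissibleColoring next hm htw r hr hra hrb, nsmul_eq_mul]
  push_cast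
  rw [← mul_assoc, ← mul_assoc, ← mul_pow]
  norm_num

end StateSum

/-! ### Vertices, edges and boundary cycles of a Möbius graph -/

namespace MobiusGraph

variable {V : Type*} {d : V → ℕ}

/-- The rotation of the half-edges around their vertices. -/
def rotation (d : V → ℕ) : Equiv.Perm (HalfEdge d) :=
  Equiv.sigmaCongrRight fun v => finRotate (d v)

theorem sameCycle_finRotate (n : ℕ) (i j : Fin n) : (finRotate n).SameCycle i j := by
  rcases n with _ | _ | n
  · exact i.elim0
  · rw [show i = j from Fin.ext (by omega)]
  · refine isCycle_finRotate.sameCycle ?_ ?_ <;>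
    · rw [← Equiv.Perm.mem_support, support_finRotate]
      exact Finset.mem_univ _

theorem sameCycle_rotation_iff (x y : HalfEdge d) :
    (rotation d).SameCycle x y ↔ x.1 = y.1 := by
  constructor
  · rintro ⟨k, rfl⟩
    induction k with
    | zero => rfl
    | succ k ih => rw [add_comm, zpow_one_add, Equiv.Perm.mul_apply, ih]; rfl
    | pred k ih =>
      have h1 : ((rotation d ^ (-(k : ℤ))) x).1 = ((rotation d ^ (-(k : ℤ) - 1)) x).1 := by
        rw [show (-(k : ℤ)) = 1 + (-k - 1) by ring, zpow_one_add, Equiv.Perm.mul_apply,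
          add_sub_cancel_left]
        rfl
      rw [ih, h1]
  · obtain ⟨v, i⟩ := x
    obtain ⟨w, j⟩ := y
    rintro (rfl : v = w)
    obtain ⟨k, hk⟩ := sameCycle_finRotate (d v) i j
    refine ⟨k, ?_⟩
    have h1 : Equiv.Perm.sigmaCongrRightHom (fun v => Fin (d v)) (fun v => finRotate (d v)) =
      rotation d := rfl
    rw [← h1, ← map_zpow, ← hk]
    rfl

/-- The cycles of the rotation are the vertices that carry half-edges; isolated vertices are
invisible to it. -/
theorem sign_rotation [Fintype V] [DecidableEq V] (d : V → ℕ) :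
    Equiv.Perm.sign (rotation d) = (-1) ^ (Fintype.card (HalfEdge d) + Nat.card {v // d v ≠ 0}) := by
  rw [Equiv.Perm.sign_eq_neg_one_pow_card_add_card_sameCycle]
  congr 2
  refine Nat.card_congr ⟨Quotient.lift
    (fun x : HalfEdge d => (⟨x.1, fun h => (Fin.cast h x.2).elim0⟩ : {v // d v ≠ 0}))
      (fun x y h => Subtype.ext ((sameCycle_rotation_iff x y).1 h)),
    fun v => Quotient.mk _ ⟨v.1, ⟨0, Nat.pos_of_ne_zero v.2⟩⟩, fun q => ?_, fun v => rfl⟩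
  induction q using Quotient.inductionOn with
  | h x => exact Quotient.sound ((sameCycle_rotation_iff _ _).2 rfl)

theorem isPerfectMatching_mate (Γ : MobiusGraph d) : IsPerfectMatching Γ.mate :=
  ⟨Γ.mate_mate, Γ.mate_ne⟩

theorem sum_prod_ribbonWeight [Fintype V] [DecidableEq V] (Γ : MobiusGraph d)
    {R : Finset (HalfEdge d)} (hR : ∀ h, Γ.mate h ∈ R ↔ h ∉ R) :
    ∑ g : HalfEdge d → Bool, ∏ h ∈ R,
        ribbonWeight (Γ.twisted h) (g ((rotation d).symm h)) (g h)
          (g ((rotation d).symm (Γ.mate h))) (g (Γ.mate h)) =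
      (-2) ^ Nat.card Γ.SideCycle * (-1) ^ R.card * (-1) ^ Nat.card {v // d v ≠ 0} := by
  have hRcard : Fintype.card (HalfEdge d) = 2 * R.card := by
    have := card_filter_eq_two_mul Γ.mate_mate hR (fun _ => True) (by simp)
    simpa using this
  have hcorner (v : V) (k : Fin (d v)) : Quot.mk Γ.SideAdj (⟨v, k⟩, true) =
      Quot.mk Γ.SideAdj (⟨v, finRotate (d v) k⟩, false) := Quot.sound (SideAdj.corner v k)
  refine (_root_.sum_prod_ribbonWeight (rotation d) Γ.isPerfectMatching_mate Γ.twisted_mate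
    Γ.SideAdj ?_ ?_ ?_ hR).trans ?_
  · rintro _ _ (⟨v, k⟩ | ⟨h, b, hh⟩ | ⟨h, b, hh⟩)
    · exact Or.inl rfl
    · exact Or.inr (by simp [ribbonMate, hh])
    · exact Or.inr (by simp [ribbonMate, hh])
  · rintro ⟨⟨v, k⟩, _ | _⟩
    · refine (hcorner v ((finRotate (d v)).symm k)).trans ?_
      rw [Equiv.apply_symm_apply]
    · exact (hcorner v k).symm
  · rintro ⟨h, b⟩
    refine (Quot.sound ?_ : Quot.mk Γ.SideAdj (h, b) = _).symm
    cases hh : Γ.twisted h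
    · simpa [ribbonMate, hh] using SideAdj.ribbon_untwisted h b hh
    · simpa [ribbonMate, hh] using SideAdj.ribbon_twisted h b hh
  · rw [sign_rotation, hRcard, pow_add, pow_mul]
    simp [SideCycle]

theorem ncard_edgeSet [Finite V] (Γ : MobiusGraph d)
    {R : Finset (HalfEdge d)} (hR : ∀ h, Γ.mate h ∈ R ↔ h ∉ R) : Γ.edgeSet.ncard = R.card := by
  classical
  have h1 : Γ.edgeSet = (fun h => s(h, Γ.mate h)) '' (R : Set (HalfEdge d)) := by
    ext e
    constructor
    · rintro ⟨h, rfl⟩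
      by_cases hh : h ∈ R
      · exact ⟨h, hh, rfl⟩
      · exact ⟨Γ.mate h, (hR h).2 hh, by simp [Γ.mate_mate, Sym2.eq_swap]⟩
    · rintro ⟨h, -, rfl⟩
      exact ⟨h, rfl⟩
  rw [h1, Set.InjOn.ncard_image, Set.ncard_coe_finset]
  intro x hx y hy hxy
  simp only [Sym2.eq_iff] at hxy
  rcases hxy with h | h
  · exact h.1
  · exact absurd hx (by rw [h.1]; exact fun h2 => (hR y).1 h2 hy)

theorem eulerChar_eq [Fintype V] (Γ : MobiusGraph d)
    {R : Finset (HalfEdge d)} (hR : ∀ h, Γ.mate h ∈ R ↔ h ∉ R) :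
    Γ.eulerChar = Fintype.card V - R.card +
      (Nat.card Γ.SideCycle + Nat.card {v : V // d v = 0} : ℕ) := by
  have : Finite Γ.SideCycle := Quot.finite _
  rw [eulerChar, Γ.ncard_edgeSet hR, Nat.card_eq_fintype_card, Face, Nat.card_sum]

end MobiusGraph

/-! ### Independence of the coordinates and distinctness of the labels -/

theorem measurable_quaternionCoord : Measurable quaternionCoord := by
  rw [measurable_pi_iff]
  intro c
  fin_cases c
  · exact Quaternion.continuous_re.measurable
  · exact Quaternion.continuous_imI.measurable
  · exact Quaternion.continuous_imJ.measurable
  · exact Quaternion.continuous_imK.measurable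

theorem iIndepFun_quaternionCoord {Ω ι : Type*} [MeasurableSpace Ω] {μ : Measure Ω}
    {Z : ι → Ω → ℍ[ℝ]} (hZ : ∀ i, IsStandardQuaternionGaussian (Z i) μ) (hindep : iIndepFun Z μ) :
    iIndepFun (fun (p : ι × Fin 4) ω => quaternionCoord (Z p.1 ω) p.2) μ := by
  have hm (i : ι) (c : Fin 4) : AEMeasurable (fun ω => quaternionCoord (Z i ω) c) μ :=
    ((hZ i).hasLaw c).aemeasurable
  -- The coordinates are only a.e. measurable, so the joint independence is proved for measurable
  -- versions and transferred back.
  let W (i : ι) (c : Fin 4) : Ω → ℝ := (hm i c).mk _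
  have hW (i : ι) (c : Fin 4) : (fun ω => quaternionCoord (Z i ω) c) =ᵐ[μ] W i c :=
    (hm i c).ae_eq_mk
  have h1 : iIndepFun (fun i ω => (W i · ω)) μ := by
    refine (hindep.comp (fun _ => quaternionCoord) fun _ => measurable_quaternionCoord).congr
      fun i => ?_
    filter_upwards [ae_all_iff.2 (hW i)] with ω hω
    exact funext hω
  have h2 (i : ι) : iIndepFun (W i) μ := (hZ i).indep.congr (hW i)
  exact (iIndepFun_uncurry' (fun i c => (hm i c).measurable_mk) h1 h2).congr
    fun p => (hW p.1 p.2).symm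

theorem integral_sq_gaussianReal : ∫ x, x ^ 2 ∂(gaussianReal 0 1) = 1 := by
  simpa using integral_pow_add_two_gaussianReal 0

theorem integral_sq_of_hasLaw_gaussianReal {Ω : Type*} [MeasurableSpace Ω] {μ : Measure Ω}
    {Y : Ω → ℝ} (hY : HasLaw Y (gaussianReal 0 1) μ) : ∫ ω, Y ω ^ 2 ∂μ = 1 := by
  rw [← integral_sq_gaussianReal, ← hY.map_eq, integral_map hY.aemeasurable (by fun_prop)]

/-- A variable independent of itself would have second moment equal to the square of its mean, 0
instead of 1. -/
theorem injective_of_iIndepFun_gaussianReal {Ω J : Type*} [MeasurableSpace Ω] {μ : Measure Ω}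
    {Y : J → Ω → ℝ} (hY : ∀ j, HasLaw (Y j) (gaussianReal 0 1) μ) (hind : iIndepFun Y μ) :
    Function.Injective Y := by
  intro p q hpq
  by_contra hne
  have h1 := (hind.indepFun hne).integral_fun_mul_eq_mul_integral
    (hY p).aemeasurable.aestronglyMeasurable (hY q).aemeasurable.aestronglyMeasurable
  have h2 : ∫ ω, Y p ω ∂μ = 0 := by
    have := integral_map (hY p).aemeasurable (f := fun x : ℝ => x) (by fun_prop)
    rw [← this, (hY p).map_eq, integral_id_gaussianReal]
  rw [h2, zero_mul, ← hpq] at h1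
  have h3 := integral_sq_of_hasLaw_gaussianReal (hY p)
  simp only [sq, h1, zero_ne_one] at h3

/-- Independent standard quaternionic Gaussian variables and their conjugates are all distinct. -/
theorem eq_iff_of_isStandardQuaternionGaussian {Ω ι : Type*} [MeasurableSpace Ω] {μ : Measure Ω}
    {Z : ι → Ω → ℍ[ℝ]} (hZ : ∀ i, IsStandardQuaternionGaussian (Z i) μ) (hindep : iIndepFun Z μ)
    (i j : ι) (η η' : Bool) :
    ((if η then star (Z i) else Z i) = (if η' then star (Z j) else Z j)) ↔ i = j ∧ η = η' := by
  constructor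
  · intro h
    have hij : i = j := by
      have h1 := injective_of_iIndepFun_gaussianReal
        (Y := fun (p : ι × Fin 4) ω => quaternionCoord (Z p.1 ω) p.2)
        (fun p => (hZ p.1).hasLaw p.2) (iIndepFun_quaternionCoord hZ hindep)
      have h2 : (i, (0 : Fin 4)) = (j, 0) := by
        refine h1 (funext fun ω => ?_)
        have h3 := congrArg QuaternionAlgebra.re (congrFun h ω)
        cases η <;> cases η' <;> simpa [quaternionCoord] using h3
      exact congrArg Prod.fst h2
    subst hij
    refine ⟨rfl, ?_⟩
    by_contra hne
    -- A variable equal to its own conjugate has no `imI` part, contradicting unit variance.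
    have h0 (ω : Ω) : quaternionCoord (Z i ω) 1 = 0 := by
      have h3 := congrArg QuaternionAlgebra.imI (congrFun h ω)
      cases η <;> cases η' <;> simp at hne h3 <;> simp [quaternionCoord] <;> linarith
    have h1 := integral_sq_of_hasLaw_gaussianReal ((hZ i).hasLaw 1)
    simp [h0] at h1
  · rintro ⟨rfl, rfl⟩
    rfl

/-! ### Expansion in matrix entries and the contribution of one graph -/

theorem prod_eq_prod_mul_of_involutive {H M : Type*} [Fintype H] [CommMonoid M] {m : H → H}
    (hm : Function.Involutive m) {R : Finset H} (hR : ∀ h, m h ∈ R ↔ h ∉ R) (F : H → M) :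
    ∏ h, F h = ∏ h ∈ R, F h * F (m h) := by
  classical
  rw [Finset.prod_mul_distrib, ← Finset.prod_mul_prod_compl R]
  congr 1
  refine Finset.prod_nbij' m m (fun h hh => (hR h).2 (Finset.mem_compl.1 hh))
    (fun h hh => Finset.mem_compl.2 fun h1 => (hR h).1 h1 hh) (fun h _ => hm h) (fun h _ => hm h)
    (fun h _ => by rw [hm h])

/-- A sum over the assignments of values to the pairs of a matching factors. -/
theorem sum_prod_matching {H C M : Type*} [Fintype H] [DecidableEq H] [Fintype C]
    [DecidableEq C] [CommSemiring M] {m : H → H}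
    (hm : Function.Involutive m) {R : Finset H} (hR : ∀ h, m h ∈ R ↔ h ∉ R) (F : H → C → M) :
    ∑ c : H → C, (if ∀ h, c (m h) = c h then ∏ h, F h (c h) else 0) =
      ∏ h ∈ R, ∑ c, F h c * F (m h) c := by
  classical
  rw [← Finset.prod_coe_sort R, Fintype.prod_sum, ← Finset.sum_filter]
  refine Finset.sum_bij' (fun c _ h => c h.1)
    (fun c _ h => if hh : h ∈ R then c ⟨h, hh⟩ else c ⟨m h, (hR h).2 hh⟩)
    (fun _ _ => Finset.mem_univ _) ?_ ?_ ?_ ?_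
  · intro c _
    rw [Finset.mem_filter]
    refine ⟨Finset.mem_univ _, fun h => ?_⟩
    by_cases hh : h ∈ R
    · have h1 : m h ∉ R := fun h1 => (hR h).1 h1 hh
      simp [hh, h1, hm h]
    · have h1 : m h ∈ R := (hR h).2 hh
      simp [hh, h1]
  · intro c hc
    ext h
    by_cases hh : h ∈ R
    · simp [hh]
    · simp [hh, (Finset.mem_filter.1 hc).2 h]
  · intro c _
    ext h
    simp
  · intro c hc
    rw [prod_eq_prod_mul_of_involutive hm hR, ← Finset.prod_coe_sort R]
    refine Finset.prod_congr rfl fun h _ => ?_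
    rw [(Finset.mem_filter.1 hc).2 h]

/-- The product of the real parts of words in quaternions, expanded in matrix entries. -/
theorem prod_re_eq_sum {V : Type*} [Fintype V] [DecidableEq V] (d : V → ℕ)
    (η : HalfEdge d → Bool) (x : HalfEdge d → ℍ[ℝ]) :
    ((∏ v, ((List.ofFn fun k : Fin (d v) =>
      (if η ⟨v, k⟩ then star (x ⟨v, k⟩) else x ⟨v, k⟩)).prod).re : ℝ) : ℂ) =
    2 ^ Nat.card {v // d v = 0} / 2 ^ Fintype.card V *
      ∑ g : HalfEdge d → Bool, ∑ c : HalfEdge d → Fin 4,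
        (∏ h, basisEntry (η h) (c h) (g ((MobiusGraph.rotation d).symm h)) (g h)) *
          ∏ h, (quaternionCoord (x h) (c h) : ℂ) := by
  have h1 (n : ℕ) (q : Fin n → ℍ[ℝ]) : ((List.ofFn q).prod.re : ℂ) =
      (if n = 0 then 2 else 1) * (∑ g : Fin n → Bool,
        ∏ j, quaternionMatrix (q j) (g ((finRotate n).symm j)) (g j)) / 2 := by
    have h2 := Matrix.trace_list_prod_ofFn n fun j => quaternionMatrix (q j)
    have h3 := trace_quaternionMatrix (List.ofFn q).prod
    rw [map_list_prod, List.map_ofFn] at h3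
    rw [Fintype.card_bool] at h2
    rw [eq_div_iff two_ne_zero, mul_comm, ← h3]
    exact_mod_cast h2
  rw [Complex.ofReal_prod]
  simp only [h1]
  rw [Finset.prod_div_distrib, Finset.prod_mul_distrib, Finset.prod_const, Finset.card_univ,
    Finset.prod_ite, Finset.prod_const, Finset.prod_const_one, mul_one, ← Fintype.card_subtype,
    ← Nat.card_eq_fintype_card, mul_div_right_comm, Fintype.prod_sum]
  congr 1
  rw [← (Equiv.piCurry (fun (v : V) (_ : Fin (d v)) => Bool)).sum_comp]
  refine Finset.sum_congr rfl fun g _ => ?_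
  simp only [← Finset.prod_mul_distrib]
  rw [← Fintype.prod_sum (fun h c => basisEntry (η h) c (g ((MobiusGraph.rotation d).symm h))
    (g h) * (quaternionCoord (x h) c : ℂ)), Fintype.prod_sigma]
  refine Finset.prod_congr rfl fun v _ => Finset.prod_congr rfl fun k _ => ?_
  rw [← quaternionMatrix_apply_eq_sum]
  rfl

/-- The parameters are the numbers of isolated vertices, other vertices, boundary cycles of sides
and ribbons. On the left, 2^p comes from traces of empty words, the denominator from halving each
trace, and 2^n from the ribbon covariances. -/
theorem neg_two_pow_mul_eq (p q f n : ℕ) :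
    (2 : ℂ) ^ p / 2 ^ (p + q) * (2 ^ n * ((-2) ^ f * (-1) ^ n * (-1) ^ q)) =
      4 ^ ((n : ℤ) - ((p + q : ℕ) : ℤ)) * (-2) ^ (((p + q : ℕ) : ℤ) - n + ((f + p : ℕ) : ℤ)) := by
  have h2 : (-2 : ℂ) ≠ 0 := by norm_num
  have h3 (k : ℕ) : (-2 : ℂ) ^ k = (-1) ^ k * 2 ^ k := by rw [← mul_pow]; norm_num
  have h4 (k : ℕ) : (4 : ℂ) ^ k = 2 ^ k * 2 ^ k := by rw [← mul_pow]; norm_num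
  have hu (k : ℕ) : ((-1 : ℂ) ^ k) * (-1) ^ k = 1 := by rw [← mul_pow]; simp
  have hk (k : ℕ) : ((2 : ℂ) ^ k) ≠ 0 := pow_ne_zero _ two_ne_zero
  have hinv : ((-1 : ℂ) ^ n * 2 ^ n)⁻¹ = (-1) ^ n * (2 ^ n)⁻¹ := by
    rw [mul_inv, inv_eq_of_mul_eq_one_right (hu n)]
  rw [zpow_add₀ h2, zpow_sub₀ h2, zpow_sub₀ (by norm_num : (4 : ℂ) ≠ 0)]
  simp only [zpow_natCast, h3, h4, pow_add]
  rw [div_eq_mul_inv _ ((-1 : ℂ) ^ n * 2 ^ n), hinv]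
  have hp := hu p
  have hkp := hk p
  have hkq := hk q
  have hkn := hk n
  generalize (-1 : ℂ) ^ p = ep at *
  generalize (2 : ℂ) ^ p = P at *
  generalize (2 : ℂ) ^ q = Q at *
  generalize (2 : ℂ) ^ n = N at *
  generalize (-1 : ℂ) ^ n = en at *
  generalize (-1 : ℂ) ^ q = eq at *
  generalize (-1 : ℂ) ^ f = ef at *
  field_simp
  linear_combination (-ef * en * eq) * hp

namespace MobiusGraph

variable {V : Type*} {d : V → ℕ}

/-- The contribution of a Möbius graph to the expectation of the product of real parts. -/
theorem sum_prod_basisEntry_eq [Fintype V] [DecidableEq V] {n : ℕ} (hn : ∑ v, d v = 2 * n)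
    (Γ : MobiusGraph d) (η : HalfEdge d → Bool)
    (hη : ∀ h, Γ.twisted h = (η h == η (Γ.mate h))) :
    (2 : ℂ) ^ Nat.card {v // d v = 0} / 2 ^ Fintype.card V *
      ∑ g : HalfEdge d → Bool, ∑ c : HalfEdge d → Fin 4,
        (if ∀ h, c (Γ.mate h) = c h then
          ∏ h, basisEntry (η h) (c h) (g ((rotation d).symm h)) (g h) else 0) =
    4 ^ ((n : ℤ) - (Fintype.card V : ℤ)) * (-2) ^ Γ.eulerChar := by
  obtain ⟨t, ht⟩ := Γ.isPerfectMatching_mate.exists_coloring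
  let R : Finset (HalfEdge d) := Finset.univ.filter fun h => t h = true
  have hR (h : HalfEdge d) : Γ.mate h ∈ R ↔ h ∉ R := by simp [R, ht]
  have hRcard : R.card = n := by
    have h1 := card_filter_eq_two_mul Γ.mate_mate hR (fun _ => True) (by simp)
    simp [hn] at h1
    exact h1.symm
  have hV : Fintype.card V = Nat.card {v // d v = 0} + Nat.card {v // d v ≠ 0} := by
    rw [Nat.card_eq_fintype_card, Nat.card_eq_fintype_card, ← Fintype.card_sum]
    exact (Fintype.card_congr (Equiv.sumCompl _)).symm
  have h1 (g : HalfEdge d → Bool) : (∑ c : HalfEdge d → Fin 4,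
      (if ∀ h, c (Γ.mate h) = c h then
        ∏ h, basisEntry (η h) (c h) (g ((rotation d).symm h)) (g h) else 0)) =
      2 ^ n * ((∏ h ∈ R, ribbonWeight (Γ.twisted h) (g ((rotation d).symm h)) (g h)
          (g ((rotation d).symm (Γ.mate h))) (g (Γ.mate h)) : ℤ) : ℂ) := by
    rw [sum_prod_matching Γ.mate_mate hR
      fun h c => basisEntry (η h) c (g ((rotation d).symm h)) (g h)]
    simp only [sum_basisEntry_mul_basisEntry, ← hη]
    rw [Finset.prod_mul_distrib, Finset.prod_const, hRcard, Int.cast_prod]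
  simp only [h1, ← Finset.mul_sum, ← Int.cast_sum]
  rw [Γ.sum_prod_ribbonWeight hR, Γ.eulerChar_eq hR, hRcard, hV]
  generalize Nat.card {v // d v = 0} = p
  generalize Nat.card {v // d v ≠ 0} = q
  generalize Nat.card Γ.SideCycle = f
  exact_mod_cast neg_two_pow_mul_eq p q f n

/-- `h1` and `h2` say that a label amounts to a variable and a conjugation bit. A ribbon must join
equal variables, and its twist is then forced by comparing the bits. -/
theorem compatible_iff {A ι : Type*} [Star A] {x : HalfEdge d → A} {I : HalfEdge d → ι}
    {η : HalfEdge d → Bool} (h1 : ∀ a b, x a = x b ↔ I a = I b ∧ η a = η b)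
    (h2 : ∀ a b, x a = star (x b) ↔ I a = I b ∧ η a = !η b) (Γ : MobiusGraph d) :
    Γ.Compatible x ↔
      (∀ h, I (Γ.mate h) = I h) ∧ ∀ h, Γ.twisted h = (η h == η (Γ.mate h)) := by
  rw [Compatible, ← forall_and]
  refine forall_congr' fun h => ?_
  rw [h1, h2]
  cases Γ.twisted h <;> cases η h <;> cases η (Γ.mate h) <;> simp

theorem mem_compatibleGraphs {A : Type*} [Finite V] [Star A] {x : HalfEdge d → A}
    {Γ : MobiusGraph d} : Γ ∈ compatibleGraphs x ↔ Γ.Compatible x := by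
  simp [compatibleGraphs]

/-- Compatible Möbius graphs correspond to perfect matchings within the classes of equal or
conjugate labels. -/
theorem sum_compatibleGraphs {A ι M : Type*} [Fintype V] [Star A] [AddCommMonoid M]
    {x : HalfEdge d → A} {I : HalfEdge d → ι}
    {η : HalfEdge d → Bool} (h1 : ∀ a b, x a = x b ↔ I a = I b ∧ η a = η b)
    (h2 : ∀ a b, x a = star (x b) ↔ I a = I b ∧ η a = !η b)
    (F : (HalfEdge d → HalfEdge d) → M) [DecidableEq V]
    [DecidablePred fun m : HalfEdge d → HalfEdge d =>
      IsPerfectMatching m ∧ ∀ h, I (m h) = I h] :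
    ∑ Γ ∈ compatibleGraphs x, F Γ.mate =
      ∑ m : HalfEdge d → HalfEdge d,
        if IsPerfectMatching m ∧ ∀ h, I (m h) = I h then F m else 0 := by
  rw [← Finset.sum_filter]
  refine Finset.sum_bij' (fun Γ _ => Γ.mate)
    (fun m hm => ⟨m, (Finset.mem_filter.1 hm).2.1.invol, (Finset.mem_filter.1 hm).2.1.ne,
      fun h => η h == η (m h), fun h => by
        rw [(Finset.mem_filter.1 hm).2.1.invol h, Bool.beq_comm]⟩) ?_ ?_ ?_ ?_ ?_
  · intro Γ hΓ
    have := (compatible_iff h1 h2 Γ).1 (mem_compatibleGraphs.1 hΓ)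
    exact Finset.mem_filter.2 ⟨Finset.mem_univ _, Γ.isPerfectMatching_mate, this.1⟩
  · intro m hm
    refine mem_compatibleGraphs.2 ((compatible_iff h1 h2 _).2 ⟨?_, fun _ => rfl⟩)
    exact (Finset.mem_filter.1 hm).2.2
  · intro Γ hΓ
    have := (compatible_iff h1 h2 Γ).1 (mem_compatibleGraphs.1 hΓ)
    exact MobiusGraph.ext rfl (funext fun h => (this.2 h).symm)
  · intro m hm
    rfl
  · intro Γ hΓ
    rfl

end MobiusGraph

/-! ### The expectation as a sum over graphs -/

theorem natCast_card_subtype_eq_sum {α R : Type*} [Fintype α] [Semiring R] (p : α → Prop)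
    [DecidablePred p] :
    (Nat.card {a // p a} : R) = ∑ a, if p a then 1 else 0 := by
  rw [Finset.sum_boole, Nat.card_eq_fintype_card, Fintype.card_subtype]

theorem mul_sum_sum_mul_sum_ite {α β γ R : Type*} [Fintype α] [Fintype β] [Fintype γ]
    [CommSemiring R] (K : R) (B : α → β → R) (P : γ → Prop) [DecidablePred P]
    (D : γ → β → Prop) [∀ m, DecidablePred (D m)] :
    K * ∑ g, ∑ c, B g c * ∑ m, (if P m ∧ D m c then (1 : R) else 0) =
      ∑ m, if P m then K * ∑ g, ∑ c, (if D m c then B g c else 0) else 0 := by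
  have h1 (m : γ) : (if P m then K * ∑ g, ∑ c, (if D m c then B g c else 0) else 0) =
      K * ∑ g, ∑ c, (if P m ∧ D m c then B g c else 0) := by
    by_cases h : P m <;> simp [h]
  simp only [h1, ← Finset.mul_sum]
  congr 1
  refine Eq.trans ?_ Finset.sum_comm
  refine Finset.sum_congr rfl fun g _ => Eq.trans ?_ Finset.sum_comm
  simp only [Finset.mul_sum, mul_ite, mul_one, mul_zero]

theorem mainTheorem1 {Ω : Type*} [MeasurableSpace Ω] (μ : Measure Ω) [IsProbabilityMeasure μ]
    {ι : Type*} (Z : ι → Ω → ℍ[ℝ])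
    (hZ : ∀ i, IsStandardQuaternionGaussian (Z i) μ)
    (hindep : iIndepFun Z μ)
    (n m : ℕ) (X : Fin (2 * n) → Ω → ℍ[ℝ])
    (hX : ∀ k, ∃ i, X k = Z i ∨ X k = star (Z i))
    (d : Fin m → ℕ) (hd : ∑ v, d v = 2 * n) :
    Integrable (reProduct d hd X) μ ∧
    ∫ ω, reProduct d hd X ω ∂μ =
      (4 : ℝ) ^ ((n : ℤ) - (m : ℤ)) *
        ∑ Γ ∈ MobiusGraph.compatibleGraphs (fun h : HalfEdge d => X (blockIndex d hd h)),
          (-2 : ℝ) ^ Γ.eulerChar := by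
  classical
  have hX' : ∀ h : HalfEdge d, ∃ p : ι × Bool,
      X (blockIndex d hd h) = if p.2 then star (Z p.1) else Z p.1 := by
    intro h
    obtain ⟨i, h1 | h1⟩ := hX (blockIndex d hd h)
    · exact ⟨(i, false), h1⟩
    · exact ⟨(i, true), h1⟩
  choose p hp using hX'
  let I : HalfEdge d → ι := fun h => (p h).1
  let η : HalfEdge d → Bool := fun h => (p h).2
  let Y : ι × Fin 4 → Ω → ℝ := fun q ω => quaternionCoord (Z q.1 ω) q.2
  have hY (q : ι × Fin 4) : HasLaw (Y q) (gaussianReal 0 1) μ := (hZ q.1).hasLaw q.2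
  have hYind : iIndepFun Y μ := iIndepFun_quaternionCoord hZ hindep
  let K : ℂ := 2 ^ Nat.card {v // d v = 0} / 2 ^ Fintype.card (Fin m)
  let B (g : HalfEdge d → Bool) (c : HalfEdge d → Fin 4) : ℂ :=
    ∏ h, basisEntry (η h) (c h) (g ((MobiusGraph.rotation d).symm h)) (g h)
  have hexp (ω : Ω) : (reProduct d hd X ω : ℂ) =
      K * ∑ g, ∑ c, B g c * ((∏ h, Y (I h, c h) ω : ℝ) : ℂ) := by
    have h1 := prod_re_eq_sum d η fun h => Z (I h) ω
    have h2 : ∏ v, ((List.ofFn fun k : Fin (d v) =>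
        (if η ⟨v, k⟩ then star (Z (I ⟨v, k⟩) ω) else Z (I ⟨v, k⟩) ω)).prod).re =
        reProduct d hd X ω := by
      refine Finset.prod_congr rfl fun v _ => ?_
      congr 3
      ext1 k
      rw [hp]
      change (if (p ⟨v, k⟩).2 then _ else _) = _
      split_ifs <;> rfl
    rw [h2] at h1
    simp only [Complex.ofReal_prod]
    exact h1
  have hint (c : HalfEdge d → Fin 4) :
      Integrable (fun ω => ((∏ h, Y (I h, c h) ω : ℝ) : ℂ)) μ :=
    (integrable_prod_of_hasLaw_gaussianReal hY hYind fun h => (I h, c h)).ofReal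
  have hintC : Integrable (fun ω => (reProduct d hd X ω : ℂ)) μ := by
    simp only [hexp]
    exact (integrable_finsetSum _ fun g _ => integrable_finsetSum _ fun c _ =>
      (hint c).const_mul _).const_mul _
  refine ⟨by simpa using hintC.re, ?_⟩
  -- Wick's condition on the pairs `(I h, c h)` splits into one on variables, which selects the
  -- graphs, and one on coordinates, which is summed within each graph.
  have hE (c : HalfEdge d → Fin 4) : ∫ ω, ((∏ h, Y (I h, c h) ω : ℝ) : ℂ) ∂μ =
      ∑ m : HalfEdge d → HalfEdge d,
        if (IsPerfectMatching m ∧ ∀ h, I (m h) = I h) ∧ ∀ h, c (m h) = c h then 1 else 0 := by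
    rw [integral_complex_ofReal, wick_iIndepFun hY hYind fun h => (I h, c h),
      Complex.ofReal_natCast, natCast_card_subtype_eq_sum]
    simp only [Prod.mk.injEq, forall_and, and_assoc]
  have hlab1 (a b : HalfEdge d) :
      X (blockIndex d hd a) = X (blockIndex d hd b) ↔ I a = I b ∧ η a = η b := by
    rw [hp, hp]
    exact eq_iff_of_isStandardQuaternionGaussian hZ hindep _ _ _ _
  have hlab2 (a b : HalfEdge d) :
      X (blockIndex d hd a) = star (X (blockIndex d hd b)) ↔ I a = I b ∧ η a = !η b := by
    rw [← eq_iff_of_isStandardQuaternionGaussian hZ hindep (I a) (I b) (η a) (!η b), hp, hp]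
    change _ = star (if η b then star (Z (I b)) else Z (I b)) ↔ _
    cases η b <;> simp [I, η]
  apply Complex.ofReal_injective
  rw [← integral_complex_ofReal]
  simp only [hexp]
  rw [integral_const_mul, integral_finsetSum _ fun g _ => integrable_finsetSum _ fun c _ =>
      (hint c).const_mul _]
  simp only [integral_finsetSum _ fun c _ => (hint c).const_mul _, integral_const_mul, hE]
  push_cast
  have hΓ : ∀ Γ ∈ MobiusGraph.compatibleGraphs (fun h : HalfEdge d => X (blockIndex d hd h)),
      (4 : ℂ) ^ ((n : ℤ) - (m : ℤ)) * (-2 : ℂ) ^ Γ.eulerChar =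
      K * ∑ g, ∑ c : HalfEdge d → Fin 4, if ∀ h, c (Γ.mate h) = c h then B g c else 0 := by
    intro Γ hΓ
    have h1 := (MobiusGraph.compatible_iff hlab1 hlab2 Γ).1 (MobiusGraph.mem_compatibleGraphs.1 hΓ)
    have h2 := Γ.sum_prod_basisEntry_eq hd η h1.2
    rw [Fintype.card_fin] at h2
    simp only [K, B, Fintype.card_fin]
    exact h2.symm
  refine (mul_sum_sum_mul_sum_ite K B
    (fun m' : HalfEdge d → HalfEdge d => IsPerfectMatching m' ∧ ∀ h, I (m' h) = I h)
    fun m' c => ∀ h, c (m' h) = c h).trans ?_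
  refine (MobiusGraph.sum_compatibleGraphs hlab1 hlab2 fun m' =>
      K * ∑ g, ∑ c : HalfEdge d → Fin 4, if ∀ h, c (m' h) = c h then B g c else 0).symm.trans ?_
  rw [Finset.mul_sum]
  exact (Finset.sum_congr rfl hΓ).symm
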